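/- Let $M$ be a Euclidean polyhedral metric on the $2$-sphere and let $T$ be a geodesic triangulation of $M$ (loops, multiple edges and triangles with identified sides are allowed), i.e. $M$ is glued from Euclidean triangles along the combinatorial scheme $T$; let $\ell_{ij}$ be the edge lengths. For a vertex $i$ let $\delta_i$ be $2\pi$ minus the sum of the angles at $i$ of the triangles of $T$ (the angular defect of $M$ at $i$). Let $r=(r_i)$ be positive numbers such that over every triangle $ijk$ of $T$ there is a nondegenerate pyramid in $\mathbb R^3$ with base $ijk$ and side edges of lengths $r_i,r_j,r_k$. Gluing these pyramids as the triangles of $T$ are glued gives the generalized polytope $P=(T,r)$ with boundary $M$; all apices become one point $a$, the apex. Its curvature at $i$ is $\kappa_i=2\pi-\omega_i$, where $\omega_i$ is the sum of the dihedral angles of the pyramids at the edge $ai$. $P$ is convex if at every boundary edge $ij$ the sum $\theta_{ij}$ of the dihedral angles of the pyramids satisfies $\theta_{ij}\le\pi$. The dual generalized polyhedron is $P^*=(T,\varphi,h)$, where $\varphi_{ij}$ is the angle at $a$ of the triangle $aij$ and $h_i=1/r_i$. With $\omega_{ijk}$ the angle at $i$ of the spherical triangle with side lengths $\varphi_{ij},\varphi_{jk},\varphi_{ik}$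 put $$h_{ij}=\frac{h_j-h_i\cos\varphi_{ij}}{\sin\varphi_{ij}},\qquad h_{ijk}=\frac{h_{ik}-h_{ij}\cos\omega_{ijk}}{\sin\omega_{ijk}},\qquad \ell^*_{ij}=h_{ijk}+h_{ijl},$$ where $ijk$ and $ijl$ are the two triangles of $T$ adjacent to the edge $ij$. The area of the $i$-th face of $P^*$ is $$F_i=\tfrac12\sum_{j}h_{ij}\,\ell^*_{ij},$$ the sum being over all edges $ij$ emanating from $i$ (a loop at $i$ is counted once for each of its two ends). Proposition. If $P$ is a generalized convex polytope with boundary $M$ and $0<\kappa_i<\delta_i$ for all $i$, then $F_i>0$ for all $i$ in the dual polyhedron $P^*$. -/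

import Mathlib

open Real

/-- Euclidean 3-space. -/
abbrev E3 : Type := EuclideanSpace ℝ (Fin 3)

/-- A triangulation of the 2-sphere; loops, multiple edges and triangles with identified sides
are allowed. `D` is the set of darts, that is, of oriented sides of the triangles: a dart `d` is a
side of exactly one triangle, whose boundary is traversed by `d`, `next d`, `next (next d)`;
along the side `d` this triangle is glued, with reversed direction, to the side `opp d`.
`org d` is the vertex at which `d` starts. -/
structure SphereTriangulation (V D : Type*) [Fintype V] [Fintype D] where
  next : Equiv.Perm D
  next_next_next : ∀ d, next (next (next d)) = d
  next_ne : ∀ d, next d ≠ d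
  opp : Equiv.Perm D
  opp_opp : ∀ d, opp (opp d) = d
  opp_ne : ∀ d, opp d ≠ d
  org : D → V
  org_surjective : Function.Surjective org
  /-- Two darts start at the same vertex iff they are related by rotations around the vertex;
  one rotation step sends `d` to the reverse of the side that precedes `d` in its triangle. -/
  org_eq_iff : ∀ d e, org d = org e ↔ (opp * next * next).SameCycle d e
  /-- The surface is connected. -/
  connected : ∀ d e, ∃ g ∈ Subgroup.closure {next, opp}, g d = e
  /-- The Euler characteristic is 2: there are `card D / 2` edges and `card D / 3` triangles. -/
  euler : (Fintype.card V : ℚ) - (Fintype.card D : ℚ) / 2 + (Fintype.card D : ℚ) / 3 = 2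

namespace SphereTriangulation

variable {V D : Type*} [Fintype V] [Fintype D] (T : SphereTriangulation V D)

/-- The third side of the triangle of `d`, i.e. the side that ends where `d` starts. -/
def prev (d : D) : D := T.next (T.next d)

theorem next_prev (d : D) : T.next (T.prev d) = d := T.next_next_next d

theorem prev_next (d : D) : T.prev (T.next d) = d := T.next_next_next d

/-- `opp d` starts where `d` ends. -/
theorem org_opp (d : D) : T.org (T.opp d) = T.org (T.next d) := by
  rw [eq_comm, T.org_eq_iff]
  refine ⟨1, ?_⟩
  simp [T.next_next_next]

theorem org_next_opp (d : D) : T.org (T.next (T.opp d)) = T.org d := by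
  rw [← T.org_opp, T.opp_opp]

end SphereTriangulation

/-- A Euclidean polyhedral metric `M` on the sphere together with a geodesic triangulation `T`
of it: the sphere is glued from Euclidean triangles with side lengths `len`. -/
structure PolyhedralSphere (V D : Type*) [Fintype V] [Fintype D]
    extends SphereTriangulation V D where
  len : D → ℝ
  len_pos : ∀ d, 0 < len d
  len_opp : ∀ d, len (opp d) = len d
  /-- Strict triangle inequality: the three sides bound a Euclidean triangle. -/
  len_lt : ∀ d, len d < len (next d) + len (next (next d))

namespace PolyhedralSphere

variable {V D : Type*} [Fintype V] [Fintype D] (M : PolyhedralSphere V D)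

/-- The angle, at the starting vertex of `d`, of the Euclidean triangle that has `d` as a side
(law of cosines). -/
noncomputable def cornerAngle (d : D) : ℝ :=
  arccos ((M.len d ^ 2 + M.len (M.prev d) ^ 2 - M.len (M.next d) ^ 2)
    / (2 * M.len d * M.len (M.prev d)))

/-- The angular defect `δ i` of `M` at `i`: `2π` minus the total angle around `i`. -/
noncomputable def defect [DecidableEq V] (i : V) : ℝ :=
  2 * π - ∑ d with M.org d = i, M.cornerAngle d

end PolyhedralSphere

/-- The dihedral angle at the edge `ℝ≥0 u` of the trihedral cone spanned by `u, v, w`: the angle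
between the components of `v` and `w` orthogonal to `u`. For unit vectors this is the angle at `u`
of the spherical triangle `u v w`. -/
noncomputable def dihedralAngle (u v w : E3) : ℝ :=
  InnerProductGeometry.angle (v - (inner ℝ u v / inner ℝ u u) • u)
    (w - (inner ℝ u w / inner ℝ u u) • u)

/-- A generalized polytope with boundary `M`, given by a couple `(T, r)`. For every triangle of `T`
there is a nondegenerate pyramid in `ℝ³` with this triangle as base and with side edges of
lengths `r`. The pyramid over the triangle of `d` is placed with its apex at `0`; its other
vertices are `pos d`, `pos (next d)`, `pos (next (next d))`, where `pos d` corresponds to the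
vertex `org d`. The pyramids are glued as the triangles of `T` are. -/
structure GenPolytope {V D : Type*} [Fintype V] [Fintype D] (M : PolyhedralSphere V D) where
  r : V → ℝ
  r_pos : ∀ i, 0 < r i
  pos : D → E3
  pos_indep : ∀ d, LinearIndependent ℝ ![pos d, pos (M.next d), pos (M.prev d)]
  norm_pos : ∀ d, ‖pos d‖ = r (M.org d)
  dist_pos : ∀ d, dist (pos d) (pos (M.next d)) = M.len d

namespace GenPolytope

variable {V D : Type*} [Fintype V] [Fintype D] {M : PolyhedralSphere V D} (P : GenPolytope M)

/-- The dihedral angle, at the side edge from the apex to `pos d`, of the pyramid over the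
triangle of `d`. -/
noncomputable def radialAngle (d : D) : ℝ :=
  dihedralAngle (P.pos d) (P.pos (M.next d)) (P.pos (M.prev d))

/-- The curvature `κ i = 2π - ω i` at the radial edge of `i`, where `ω i` is the sum of the
dihedral angles of the pyramids at this edge. -/
noncomputable def curvature [DecidableEq V] (i : V) : ℝ :=
  2 * π - ∑ d with M.org d = i, P.radialAngle d

/-- The dihedral angle, at the base edge `d`, of the pyramid over the triangle of `d`. -/
noncomputable def baseAngle (d : D) : ℝ :=
  dihedralAngle (P.pos (M.next d) - P.pos d) (0 - P.pos d) (P.pos (M.prev d) - P.pos d)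

/-- The polytope is convex: the total dihedral angle `θ` at each boundary edge is at most `π`. -/
def IsConvex : Prop := ∀ d, P.baseAngle d + P.baseAngle (M.opp d) ≤ π

end GenPolytope

/-- A generalized simplicial fan `(T, φ)`: every triangle of `T` has a realization as a
nondegenerate spherical triangle with side lengths `φ`; the vertices of the triangle of `d` are
realized by the unit vectors `vec d`, `vec (next d)`, `vec (next (next d))`. -/
structure GenFan {V D : Type*} [Fintype V] [Fintype D] (T : SphereTriangulation V D) where
  φ : D → ℝ
  φ_mem : ∀ d, φ d ∈ Set.Ioo 0 π
  φ_opp : ∀ d, φ (T.opp d) = φ d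
  vec : D → E3
  norm_vec : ∀ d, ‖vec d‖ = 1
  vec_indep : ∀ d, LinearIndependent ℝ ![vec d, vec (T.next d), vec (T.prev d)]
  angle_vec : ∀ d, InnerProductGeometry.angle (vec d) (vec (T.next d)) = φ d

/-- A generalized polyhedron `(T, φ, h)`: a generalized simplicial fan with altitudes `h`. -/
structure GenPolyhedron {V D : Type*} [Fintype V] [Fintype D] (T : SphereTriangulation V D)
    extends GenFan T where
  h : V → ℝ

namespace GenPolyhedron

variable {V D : Type*} [Fintype V] [Fintype D] {T : SphereTriangulation V D} (Q : GenPolyhedron T)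

/-- `ω_ijk`: the angle, at the starting vertex `i` of `d`, of the spherical triangle of `d`. -/
noncomputable def ω (d : D) : ℝ :=
  dihedralAngle (Q.vec d) (Q.vec (T.next d)) (Q.vec (T.prev d))

/-- `h_ij = (h_j - h_i cos φ_ij) / sin φ_ij`, where `d` goes from `i` to `j`. -/
noncomputable def hEdge (d : D) : ℝ :=
  (Q.h (T.org (T.next d)) - Q.h (T.org d) * cos (Q.φ d)) / sin (Q.φ d)

/-- `h_ijk = (h_ik - h_ij cos ω_ijk) / sin ω_ijk`, where `d` goes from `i` to `j`, and `ijk` is the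
triangle of `d`. The dart from `i` to `k` is the reverse of `prev d`. -/
noncomputable def hLeft (d : D) : ℝ :=
  (Q.hEdge (T.opp (T.prev d)) - Q.hEdge d * cos (Q.ω d)) / sin (Q.ω d)

/-- `h_ijl = (h_il - h_ij cos ω_ijl) / sin ω_ijl`, where `d` goes from `i` to `j`, and `jil` is the
triangle of `opp d`. The dart from `i` to `l` is `next (opp d)`. -/
noncomputable def hRight (d : D) : ℝ :=
  (Q.hEdge (T.next (T.opp d)) - Q.hEdge d * cos (Q.ω (T.next (T.opp d))))
    / sin (Q.ω (T.next (T.opp d)))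

/-- The edge length `ℓ*_ij = h_ijk + h_ijl`. -/
noncomputable def edgeLength (d : D) : ℝ := Q.hLeft d + Q.hRight d

/-- The area `F_i = (1/2) ∑_j h_ij ℓ*_ij` of the `i`-th face; the sum is over the edge germs
at `i`. -/
noncomputable def faceArea [DecidableEq V] (i : V) : ℝ :=
  (1 / 2) * ∑ d with T.org d = i, Q.hEdge d * Q.edgeLength d

end GenPolyhedron

namespace GenPolytope

variable {V D : Type*} [Fintype V] [Fintype D] {M : PolyhedralSphere V D} (P : GenPolytope M)

theorem pos_ne_zero (d : D) : P.pos d ≠ 0 := by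
  have := P.r_pos (M.org d)
  rw [← P.norm_pos] at this
  exact norm_pos_iff.1 this

/-- The angle at the apex of the triangle over the edge `d`. -/
noncomputable def apexAngle (d : D) : ℝ :=
  InnerProductGeometry.angle (P.pos d) (P.pos (M.next d))

theorem apexAngle_mem (d : D) : P.apexAngle d ∈ Set.Ioo 0 π := by
  have hli : LinearIndependent ℝ ![P.pos d, P.pos (M.next d)] := by
    have := (P.pos_indep d).comp ![0, 1] (by decide)
    convert this using 1
    ext i : 1
    fin_cases i <;> rfl
  refine ⟨lt_of_le_of_ne (InnerProductGeometry.angle_nonneg _ _) fun h => ?_,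
    lt_of_le_of_ne (InnerProductGeometry.angle_le_pi _ _) fun h => ?_⟩
  · obtain ⟨-, c, -, hc⟩ := InnerProductGeometry.angle_eq_zero_iff.1 h.symm
    have := LinearIndependent.pair_iff.1 hli c (-1) (by rw [hc]; simp)
    simp at this
  · obtain ⟨-, c, -, hc⟩ := InnerProductGeometry.angle_eq_pi_iff.1 h
    have := LinearIndependent.pair_iff.1 hli c (-1) (by rw [hc]; simp)
    simp at this

theorem apexAngle_opp (d : D) : P.apexAngle (M.opp d) = P.apexAngle d := by
  have key : ∀ x y : E3, InnerProductGeometry.angle x y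
      = arccos ((‖x‖ * ‖x‖ + ‖y‖ * ‖y‖ - dist x y * dist x y) / 2 / (‖x‖ * ‖y‖)) := by
    intro x y
    rw [InnerProductGeometry.angle, dist_eq_norm,
      real_inner_eq_norm_mul_self_add_norm_mul_self_sub_norm_sub_mul_self_div_two]
  unfold apexAngle
  rw [key, key, P.dist_pos, P.dist_pos, M.len_opp, P.norm_pos, P.norm_pos, P.norm_pos, P.norm_pos,
    M.org_opp, M.org_next_opp, mul_comm (P.r (M.org d)) (P.r (M.org (M.next d))),
    add_comm (P.r (M.org d) * _)]

/-- The spherical section of `P` centered at the apex. -/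
noncomputable def sphericalSection : GenFan M.toSphereTriangulation where
  φ := P.apexAngle
  φ_mem := P.apexAngle_mem
  φ_opp := P.apexAngle_opp
  vec d := ‖P.pos d‖⁻¹ • P.pos d
  norm_vec d := by
    rw [norm_smul, norm_inv, norm_norm, inv_mul_cancel₀ (norm_ne_zero_iff.2 (P.pos_ne_zero d))]
  vec_indep d := by
    have h : ∀ d, ‖P.pos d‖⁻¹ ≠ 0 := fun d => inv_ne_zero (norm_ne_zero_iff.2 (P.pos_ne_zero d))
    have := (P.pos_indep d).units_smul
      ![Units.mk0 _ (h d), Units.mk0 _ (h (M.next d)), Units.mk0 _ (h (M.prev d))]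
    convert this using 1
    ext i : 1
    fin_cases i <;> rfl
  angle_vec d := by
    have h : ∀ d, 0 < ‖P.pos d‖⁻¹ := fun d => inv_pos.2 (norm_pos_iff.2 (P.pos_ne_zero d))
    rw [InnerProductGeometry.angle_smul_left_of_pos _ _ (h _),
      InnerProductGeometry.angle_smul_right_of_pos _ _ (h _)]
    rfl

/-- The generalized polyhedron `P* = (T, φ, h)` dual to `P`, with altitudes `h i = 1 / r i`. -/
noncomputable def dual : GenPolyhedron M.toSphereTriangulation where
  toGenFan := P.sphericalSection
  h i := 1 / P.r i

end GenPolytope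

/-! Scale the `i`-th face of the dual by `r i` and place it in the plane tangent to the unit sphere.
Its support numbers become the cotangents `H` of the angles at `i` in the triangles over the edges,
and successive normals enclose the dihedral angles `ω`, whose sum is `2π - κ i < 2π`. Convexity of
the polytope says that the edge lengths of this polygon are nonnegative. Projected to the sphere
from its center, the polygon has signed area `∑ (ω - corner angle) = δ i - κ i > 0`
(`legArea_add_legArea`, `excess_starChain`). It remains to show that positive signed spherical area
forces positive signed Euclidean area.

If all `H` are nonnegative, both areas are sums of nonnegative terms that vanish together. If all
`H` are nonpositive, the spherical area is nonpositive. In the mixed case, the polygon is cut open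
where `H` becomes positive. The bound on the total angle confines the vertices to an open half
plane. The edges with positive `H` run forward over a range `[a, b]` of polar angles, the others run
backward over `[a - κ, b]`. The inverse radius is a maximum of sinusoids `p` on the outer part and a
minimum of sinusoids `n` on the inner part, so each area is an integral over the outer part minus
one over the inner part.

Let `f` be the density of the spherical area minus `l` times that of the Euclidean area, as a
function of the inverse radius. For `l = (c / √(1 + c²))³` it increases up to `c`, then decreases
and stays nonnegative. The comparison theorem `dominatedBelow` provides a level `c`, depending on
the two curves, for which the integral of `f` over the outer part is at most that over the inner
part. Thus spherical area minus `l` times Euclidean area is nonpositive, and the Euclidean area is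
positive. -/

/-! ### Sinusoids and convexity in polar coordinates. -/

/-- Trigonometric polynomials of degree one without constant term. -/
def IsSinusoid (g : ℝ → ℝ) : Prop := ∃ a b, ∀ t, g t = a * cos t + b * sin t

namespace IsSinusoid

variable {g : ℝ → ℝ}

theorem three_point (hg : IsSinusoid g) (x y z : ℝ) :
    g y * sin (z - x) = g x * sin (z - y) + g z * sin (y - x) := by
  obtain ⟨a, b, h⟩ := hg
  simp only [h, sin_sub]
  ring

theorem nonneg_of_ends (hg : IsSinusoid g) {x y z : ℝ} (hxy : x ≤ y) (hyz : y ≤ z)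
    (hzx : z - x < π) (hx : 0 ≤ g x) (hz : 0 ≤ g z) : 0 ≤ g y := by
  rcases hxy.eq_or_lt with rfl | hxy'
  · exact hx
  have h := hg.three_point x y z
  have h1 : 0 ≤ sin (z - y) := sin_nonneg_of_nonneg_of_le_pi (by linarith) (by linarith)
  have h2 : 0 ≤ sin (y - x) := sin_nonneg_of_nonneg_of_le_pi (by linarith) (by linarith)
  have h3 : 0 < sin (z - x) := sin_pos_of_pos_of_lt_pi (by linarith) hzx
  by_contra hn
  nlinarith [mul_nonneg hx h1, mul_nonneg hz h2, mul_pos (neg_pos.2 (not_le.1 hn)) h3]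

theorem pos_of_ends (hg : IsSinusoid g) {x y z : ℝ} (hxy : x ≤ y) (hyz : y ≤ z)
    (hzx : z - x < π) (hx : 0 < g x) (hz : 0 < g z) : 0 < g y := by
  rcases hxy.eq_or_lt with rfl | hxy'
  · exact hx
  have h := hg.three_point x y z
  have h1 : 0 ≤ sin (z - y) := sin_nonneg_of_nonneg_of_le_pi (by linarith) (by linarith)
  have h2 : 0 < sin (y - x) := sin_pos_of_pos_of_lt_pi (by linarith) (by linarith)
  have h3 : 0 < sin (z - x) := sin_pos_of_pos_of_lt_pi (by linarith) hzx
  have := add_pos_of_nonneg_of_pos (mul_nonneg hx.le h1) (mul_pos hz h2)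
  rw [← h] at this
  exact pos_of_mul_pos_left this h3.le

theorem neg (hg : IsSinusoid g) : IsSinusoid fun t => -g t := by
  obtain ⟨a, b, h⟩ := hg
  exact ⟨-a, -b, fun t => by simp only [h]; ring⟩

theorem sub {f : ℝ → ℝ} (hf : IsSinusoid f) (hg : IsSinusoid g) :
    IsSinusoid fun t => f t - g t := by
  obtain ⟨a, b, h⟩ := hf
  obtain ⟨a', b', h'⟩ := hg
  exact ⟨a - a', b - b', fun t => by simp only [h, h']; ring⟩

theorem cos_sub_div (t c : ℝ) : IsSinusoid fun s => cos (s - t) / c :=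
  ⟨cos t / c, sin t / c, fun s => by simp only [cos_sub]; ring⟩

theorem continuous (hg : IsSinusoid g) : Continuous g := by
  obtain ⟨a, b, h⟩ := hg
  rw [funext h]
  fun_prop

/-- Polar form, with the phase in a half circle on which the sinusoid is positive at the centre. -/
theorem exists_polar (hg : IsSinusoid g) {φ : ℝ} (hφ : 0 < g φ) :
    ∃ R θ : ℝ, 0 < R ∧ |θ - φ| < π / 2 ∧ ∀ t, g t = R * cos (t - θ) := by
  obtain ⟨a, b, h⟩ := hg
  have e1 : g φ = a * cos φ + b * sin φ := h φ
  set X := g φ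
  set Y := b * cos φ - a * sin φ with hY
  refine ⟨√(X ^ 2 + Y ^ 2), φ + arctan (Y / X), by positivity, ?_, fun t => ?_⟩
  · rw [add_sub_cancel_left, abs_lt]
    exact ⟨neg_pi_div_two_lt_arctan _, arctan_lt_pi_div_two _⟩
  · have hs : √(X ^ 2 + Y ^ 2) = X * √(1 + (Y / X) ^ 2) := by
      rw [sqrt_eq_iff_mul_self_eq (by positivity) (by positivity)]
      have := mul_self_sqrt (show 0 ≤ 1 + (Y / X) ^ 2 by positivity)
      field_simp at this ⊢
      linear_combination -this
    have hpos : 0 < √(1 + (Y / X) ^ 2) := by positivity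
    rw [← sub_sub, cos_sub, cos_arctan, sin_arctan, hs, h, cos_sub, sin_sub]
    field_simp
    rw [hY, e1]
    have hc := sin_sq_add_cos_sq φ
    linear_combination (-(a * cos t) - b * sin t) * hc

end IsSinusoid

theorem sin_add_ge_of_le_pi {x y : ℝ} (hx : 0 ≤ x) (hy : 0 ≤ y) (hxy : x + y ≤ π) :
    sin (x + y) ≤ sin x + sin y := by
  have h1 := sin_nonneg_of_nonneg_of_le_pi hx (by linarith)
  have h2 := sin_nonneg_of_nonneg_of_le_pi hy (by linarith)
  rw [sin_add]
  nlinarith [mul_nonneg h1 (sub_nonneg.2 (cos_le_one y)),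
    mul_nonneg h2 (sub_nonneg.2 (cos_le_one x))]

/-- `k` lies above the sinusoid through any two of its values: the curve `R = 1 / k` in polar
coordinates lies on the side of the origin of each of its chords. -/
def SinConcaveOn (s : Set ℝ) (k : ℝ → ℝ) : Prop :=
  ∀ x ∈ s, ∀ y ∈ s, ∀ z ∈ s, x ≤ y → y ≤ z →
    k x * sin (z - y) + k z * sin (y - x) ≤ k y * sin (z - x)

/-- `k` lies below the sinusoid through any two of its values. -/
def SinConvexOn (s : Set ℝ) (k : ℝ → ℝ) : Prop :=
  ∀ x ∈ s, ∀ y ∈ s, ∀ z ∈ s, x ≤ y → y ≤ z →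
    k y * sin (z - x) ≤ k x * sin (z - y) + k z * sin (y - x)

/-- A nonnegative constant lies below the sinusoid with the same end values, by subadditivity of
`sin`, and that sinusoid lies below `n`. So `n` is quasiconcave at nonnegative levels. -/
theorem SinConcaveOn.min_le {l u : ℝ} {n : ℝ → ℝ} (hn : SinConcaveOn (Set.Icc l u) n)
    (hlu : u - l < π) {x y z c : ℝ} (hx : l ≤ x) (hxy : x ≤ y) (hyz : y ≤ z) (hz : z ≤ u)
    (hc : 0 ≤ c) (hcx : c ≤ n x) (hcz : c ≤ n z) : c ≤ n y := by
  rcases hxy.eq_or_lt with rfl | hxy'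
  · exact hcx
  have h := hn x ⟨hx, by linarith⟩ y ⟨by linarith, by linarith⟩ z ⟨by linarith, hz⟩ hxy hyz
  have h1 : 0 ≤ sin (z - y) := sin_nonneg_of_nonneg_of_le_pi (by linarith) (by linarith)
  have h2 : 0 ≤ sin (y - x) := sin_nonneg_of_nonneg_of_le_pi (by linarith) (by linarith)
  have h3 : 0 < sin (z - x) := sin_pos_of_pos_of_lt_pi (by linarith) (by linarith)
  have h4 := sin_add_ge_of_le_pi (x := z - y) (y := y - x) (by linarith) (by linarith)
    (by linarith)
  rw [show z - y + (y - x) = z - x by ring] at h4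
  have h5 : c * sin (z - x) ≤ n y * sin (z - x) := by
    nlinarith [mul_le_mul_of_nonneg_right hcx h1, mul_le_mul_of_nonneg_right hcz h2,
      mul_le_mul_of_nonneg_left h4 hc]
  exact le_of_mul_le_mul_right h5 h3

/-- A sin-convex function stays below a sin-concave one between two points where it does. -/
theorem SinConvexOn.le_of_ends {l u : ℝ} {p : ℝ → ℝ} (hp : SinConvexOn (Set.Icc l u) p)
    {x y z A B C : ℝ} (hx : l ≤ x) (hxy : x ≤ y) (hyz : y ≤ z) (hz : z ≤ u) (hlt : x < z)
    (hzx : z - x < π) (hA : p x ≤ A) (hC : p z ≤ C)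
    (hB : A * sin (z - y) + C * sin (y - x) ≤ B * sin (z - x)) : p y ≤ B := by
  have h := hp x ⟨hx, by linarith⟩ y ⟨by linarith, by linarith⟩ z ⟨by linarith, hz⟩ hxy hyz
  have h1 : 0 ≤ sin (z - y) := sin_nonneg_of_nonneg_of_le_pi (by linarith) (by linarith)
  have h2 : 0 ≤ sin (y - x) := sin_nonneg_of_nonneg_of_le_pi (by linarith) (by linarith)
  have h3 : 0 < sin (z - x) := sin_pos_of_pos_of_lt_pi (by linarith) (by linarith)
  refine le_of_mul_le_mul_right ?_ h3
  nlinarith [mul_le_mul_of_nonneg_right hA h1, mul_le_mul_of_nonneg_right hC h2]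

/-! ### Comparison of weighted integrals over the outer and the inner curve. -/

/-- For every weight that is monotone up to some level `c`, and antitone and nonnegative from there
on, the integral of `p` over `[a, b]` is at most that of `n` over the longer interval
`[a - κ, b]`. -/
def DominatedBelow (p n : ℝ → ℝ) (a b κ : ℝ) : Prop :=
  ∃ c > 0, ∀ f : ℝ → ℝ, ContinuousOn f (Set.Ioi 0) → AntitoneOn f (Set.Ici c) →
    MonotoneOn f (Set.Ioc 0 c) → (∀ u, c ≤ u → 0 ≤ f u) →
    ∫ s in a..b, f (p s) ≤ ∫ s in (a - κ)..b, f (n s)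

theorem intervalIntegrable_comp_of_pos {f k : ℝ → ℝ} {a b x y : ℝ}
    (hf : ContinuousOn f (Set.Ioi 0)) (hk : ContinuousOn k (Set.Icc a b))
    (hpos : ∀ s ∈ Set.Icc a b, 0 < k s) (hx : a ≤ x) (hxy : x ≤ y) (hy : y ≤ b) :
    IntervalIntegrable (fun s => f (k s)) MeasureTheory.volume x y := by
  refine ContinuousOn.intervalIntegrable ?_
  rw [Set.uIcc_of_le hxy]
  have hsub : Set.Icc x y ⊆ Set.Icc a b := Set.Icc_subset_Icc hx hy
  exact hf.comp (hk.mono hsub) fun s hs => hpos s (hsub hs)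

section

variable {p n : ℝ → ℝ} {a b κ : ℝ}

/-- The drop from `n (a - κ)` to `n a` makes `n` antitone on `[a, b]`. Let `x₀` be the first point
with `p ≤ n` and `c = n x₀`. Before `x₀` one has `c ≤ n < p`, where `f` decreases; after it `p ≤ n ≤
c`, where `f` increases. Either way `f ∘ p ≤ f ∘ n`, and on the extra interval `n ≥ c`, so that it
contributes a nonnegative amount. -/
theorem dominatedBelow_of_left (hab : a ≤ b) (hκ : 0 < κ) (hw : b - (a - κ) < π)
    (hpc : ContinuousOn p (Set.Icc a b)) (hnc : ContinuousOn n (Set.Icc (a - κ) b))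
    (hp0 : ∀ s ∈ Set.Icc a b, 0 < p s) (hn0 : ∀ s ∈ Set.Icc (a - κ) b, 0 < n s)
    (hp : SinConvexOn (Set.Icc a b) p) (hn : SinConcaveOn (Set.Icc (a - κ) b) n)
    (hb : p b ≤ n b) (hlt : n a < n (a - κ)) : DominatedBelow p n a b κ := by
  have hna : ∀ s, a - κ ≤ s → s ≤ a → n a ≤ n s := fun s h1 h2 =>
    hn.min_le hw le_rfl h1 h2 hab (hn0 a ⟨by linarith, hab⟩).le hlt.le le_rfl
  have hanti : ∀ x y, a ≤ x → x ≤ y → y ≤ b → n y ≤ n x := by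
    intro x y hx hxy hy
    by_contra! hxy'
    have hnx : n (a - κ) ≤ n x ∨ n (a - κ) > n x := le_or_gt _ _
    have h0 : 0 ≤ n x := (hn0 x ⟨by linarith, by linarith⟩).le
    rcases hnx with h | h
    · have := hn.min_le hw le_rfl (by linarith) hx (by linarith)
        (hn0 (a - κ) ⟨le_rfl, by linarith⟩).le le_rfl h
      linarith
    · set c := min (n (a - κ)) (n y)
      have hc : n x < c := lt_min h hxy'
      have := hn.min_le hw (c := c) le_rfl (show a - κ ≤ x by linarith) hxy hy (by linarith)
        (min_le_left _ _) (min_le_right _ _)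
      linarith
  have hncab : ContinuousOn n (Set.Icc a b) := hnc.mono (Set.Icc_subset_Icc (by linarith) le_rfl)
  set E := {s ∈ Set.Icc a b | p s ≤ n s} with hE
  have hEc : IsClosed E := isClosed_Icc.isClosed_le hpc hncab
  have hEn : E.Nonempty := ⟨b, ⟨hab, le_rfl⟩, hb⟩
  have hEb : BddBelow E := ⟨a, fun s hs => hs.1.1⟩
  set x₀ := sInf E with hx₀
  obtain ⟨⟨h1, h2⟩, h3⟩ : x₀ ∈ E := hEc.csInf_mem hEn hEb
  have hbelow : ∀ s, a ≤ s → s < x₀ → n s < p s := by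
    intro s h4 h5
    by_contra! h6
    exact absurd (csInf_le hEb (show s ∈ E from ⟨⟨h4, by linarith⟩, h6⟩)) (by linarith)
  have habove : ∀ s, x₀ ≤ s → s ≤ b → p s ≤ n s := by
    intro s h4 h5
    rcases h4.eq_or_lt with rfl | h4'
    · exact h3
    · refine hp.le_of_ends h1 h4 h5 le_rfl (by linarith) (by linarith) h3 hb ?_
      exact hn x₀ ⟨by linarith, h2⟩ s ⟨by linarith, h5⟩ b ⟨by linarith, le_rfl⟩ h4 h5
  refine ⟨n x₀, hn0 x₀ ⟨by linarith, h2⟩, fun f hf hfa hfm hf0 => ?_⟩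
  have hpt : ∀ s ∈ Set.Icc a b, f (p s) ≤ f (n s) := by
    rintro s ⟨hs1, hs2⟩
    rcases lt_or_ge s x₀ with h | h
    · have e1 := hanti s x₀ hs1 h.le h2
      have e2 := hbelow s hs1 h
      exact hfa e1 (e1.trans e2.le) e2.le
    · have e1 := hanti x₀ s h1 h hs2
      have e2 := habove s h hs2
      exact hfm ⟨hp0 s ⟨hs1, hs2⟩, e2.trans e1⟩ ⟨hn0 s ⟨by linarith, hs2⟩, e1⟩ e2
  have i1 := intervalIntegrable_comp_of_pos hf hnc hn0 le_rfl (show a - κ ≤ a by linarith) hab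
  have i2 := intervalIntegrable_comp_of_pos hf hnc hn0 (show a - κ ≤ a by linarith) hab le_rfl
  have i3 := intervalIntegrable_comp_of_pos hf hpc hp0 le_rfl hab le_rfl
  rw [← intervalIntegral.integral_add_adjacent_intervals i1 i2]
  have j1 : 0 ≤ ∫ s in (a - κ)..a, f (n s) :=
    intervalIntegral.integral_nonneg (by linarith) fun s hs =>
      hf0 _ ((hanti a x₀ le_rfl h1 h2).trans (hna s hs.1 hs.2))
  have j2 := intervalIntegral.integral_mono_on hab i3 i2 hpt
  linarith

/-- The intermediate value theorem gives an interval `[τ, τ + κ]` at whose ends `n` has the same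
value `c`. Inside it `n ≥ c`, so its contribution is nonnegative and can be dropped. Outside it `n ≤
c`, where `f` increases. After the left remainder is shifted by `κ`, the two remainders cover `[a,
b]` and lie above `p`. -/
theorem dominatedBelow_of_middle (hab : a ≤ b) (hκ : 0 < κ) (hw : b - (a - κ) < π)
    (hpc : ContinuousOn p (Set.Icc a b)) (hnc : ContinuousOn n (Set.Icc (a - κ) b))
    (hp0 : ∀ s ∈ Set.Icc a b, 0 < p s) (hn0 : ∀ s ∈ Set.Icc (a - κ) b, 0 < n s)
    (hp : SinConvexOn (Set.Icc a b) p) (hn : SinConcaveOn (Set.Icc (a - κ) b) n)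
    (ha : p a ≤ n (a - κ)) (hb : p b ≤ n b) (hna : n (a - κ) ≤ n a) (hnb : n b ≤ n (b - κ)) :
    DominatedBelow p n a b κ := by
  obtain ⟨τ, ⟨hτ1, hτ2⟩, hτ⟩ : ∃ τ ∈ Set.Icc (a - κ) (b - κ), n (τ + κ) - n τ = 0 := by
    have hc : ContinuousOn (fun τ => n (τ + κ) - n τ) (Set.Icc (a - κ) (b - κ)) := by
      refine ContinuousOn.sub (hnc.comp (by fun_prop) ?_) (hnc.mono ?_)
      · rintro s ⟨h1, h2⟩
        exact ⟨by linarith, by linarith⟩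
      · exact Set.Icc_subset_Icc le_rfl (by linarith)
    have := intermediate_value_Icc' (show a - κ ≤ b - κ by linarith) hc
    refine this ⟨?_, ?_⟩
    · simpa using hnb
    · simpa using hna
  have hτ' : n (τ + κ) = n τ := by linarith
  have hc0 : 0 < n τ := hn0 τ ⟨hτ1, by linarith⟩
  have hsκ : 0 < sin κ := sin_pos_of_pos_of_lt_pi hκ (by linarith)
  have hleft : ∀ s, a - κ ≤ s → s ≤ τ → n s ≤ n τ := by
    intro s h1 h2
    have h := hn s ⟨h1, by linarith⟩ τ ⟨hτ1, by linarith⟩ (τ + κ) ⟨by linarith, by linarith⟩ h2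
      (by linarith)
    have h4 := sin_add_ge_of_le_pi (x := κ) (y := τ - s) hκ.le (by linarith) (by linarith)
    rw [hτ', show τ + κ - τ = κ by ring, show τ + κ - s = κ + (τ - s) by ring] at h
    refine le_of_mul_le_mul_right ?_ hsκ
    nlinarith [mul_le_mul_of_nonneg_left h4 hc0.le]
  have hright : ∀ s, τ + κ ≤ s → s ≤ b → n s ≤ n τ := by
    intro s h1 h2
    have h := hn τ ⟨by linarith, by linarith⟩ (τ + κ) ⟨by linarith, by linarith⟩ s
      ⟨by linarith, by linarith⟩ (by linarith) h1
    have h4 := sin_add_ge_of_le_pi (x := s - (τ + κ)) (y := κ) (by linarith) hκ.le (by linarith)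
    rw [hτ', show τ + κ - τ = κ by ring, show s - τ = s - (τ + κ) + κ by ring] at h
    refine le_of_mul_le_mul_right ?_ hsκ
    nlinarith [mul_le_mul_of_nonneg_left h4 hc0.le]
  have hmid : ∀ s, τ ≤ s → s ≤ τ + κ → n τ ≤ n s := fun s h1 h2 =>
    hn.min_le hw hτ1 h1 h2 (by linarith) hc0.le le_rfl hτ'.ge
  have hcmp1 : ∀ s, a ≤ s → s ≤ τ + κ → p s ≤ n (s - κ) := by
    intro s h1 h2
    rcases hab.eq_or_lt with rfl | hab'
    · rw [show s = a by linarith]; exact ha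
    · refine hp.le_of_ends le_rfl h1 (by linarith) le_rfl hab' (by linarith) ha (hb.trans hnb) ?_
      have := hn (a - κ) ⟨by linarith, by linarith⟩ (s - κ) ⟨by linarith, by linarith⟩ (b - κ)
        ⟨by linarith, by linarith⟩ (by linarith) (by linarith)
      rwa [sub_sub_sub_cancel_right, sub_sub_sub_cancel_right, sub_sub_sub_cancel_right] at this
  have hcmp2 : ∀ s, τ + κ ≤ s → s ≤ b → p s ≤ n s := by
    intro s h1 h2
    rcases hab.eq_or_lt with rfl | hab'
    · rw [show s = a by linarith]; exact hb
    · refine hp.le_of_ends le_rfl (by linarith) h2 le_rfl hab' (by linarith) (ha.trans hna) hb ?_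
      exact hn a ⟨by linarith, by linarith⟩ s ⟨by linarith, by linarith⟩ b
        ⟨by linarith, by linarith⟩ (by linarith) (by linarith)
  refine ⟨n τ, hc0, fun f hf hfa hfm hf0 => ?_⟩
  have i1 := intervalIntegrable_comp_of_pos hf hnc hn0 le_rfl hτ1 (show τ ≤ b by linarith)
  have i2 := intervalIntegrable_comp_of_pos hf hnc hn0 hτ1 (show τ ≤ τ + κ by linarith)
    (by linarith)
  have i3 := intervalIntegrable_comp_of_pos hf hnc hn0 (show a - κ ≤ τ + κ by linarith)
    (show τ + κ ≤ b by linarith) le_rfl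
  have i4 := intervalIntegrable_comp_of_pos hf hpc hp0 le_rfl (show a ≤ τ + κ by linarith)
    (by linarith)
  have i5 := intervalIntegrable_comp_of_pos hf hpc hp0 (show a ≤ τ + κ by linarith)
    (show τ + κ ≤ b by linarith) le_rfl
  rw [← intervalIntegral.integral_add_adjacent_intervals i4 i5,
    ← intervalIntegral.integral_add_adjacent_intervals (i1.trans i2) i3,
    ← intervalIntegral.integral_add_adjacent_intervals i1 i2]
  have hshift : ∫ s in (a - κ)..τ, f (n s) = ∫ s in a..(τ + κ), f (n (s - κ)) := by
    rw [intervalIntegral.integral_comp_sub_right (fun s => f (n s)), add_sub_cancel_right]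
  have i1' : IntervalIntegrable (fun s => f (n (s - κ))) MeasureTheory.volume a (τ + κ) := by
    have := i1.comp_sub_right κ
    rwa [sub_add_cancel] at this
  have j1 : ∫ s in a..(τ + κ), f (p s) ≤ ∫ s in a..(τ + κ), f (n (s - κ)) := by
    refine intervalIntegral.integral_mono_on (by linarith) i4 i1' fun s hs => ?_
    have e1 := hcmp1 s hs.1 hs.2
    have e2 := hleft (s - κ) (by linarith [hs.1]) (by linarith [hs.2])
    have e3 := hp0 s ⟨hs.1, by linarith [hs.2]⟩
    exact hfm ⟨e3, e1.trans e2⟩ ⟨e3.trans_le e1, e2⟩ e1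
  have j2 : 0 ≤ ∫ s in τ..(τ + κ), f (n s) :=
    intervalIntegral.integral_nonneg (by linarith) fun s hs => hf0 _ (hmid s hs.1 hs.2)
  have j3 : ∫ s in (τ + κ)..b, f (p s) ≤ ∫ s in (τ + κ)..b, f (n s) := by
    refine intervalIntegral.integral_mono_on (by linarith) i5 i3 fun s hs => ?_
    have e1 := hcmp2 s hs.1 hs.2
    have e2 := hright s hs.1 hs.2
    have e3 := hp0 s ⟨by linarith [hs.1], hs.2⟩
    exact hfm ⟨e3, e1.trans e2⟩ ⟨e3.trans_le e1, e2⟩ e1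
  linarith

theorem dominatedBelow (hab : a ≤ b) (hκ : 0 < κ) (hw : b - (a - κ) < π)
    (hpc : ContinuousOn p (Set.Icc a b)) (hnc : ContinuousOn n (Set.Icc (a - κ) b))
    (hp0 : ∀ s ∈ Set.Icc a b, 0 < p s) (hn0 : ∀ s ∈ Set.Icc (a - κ) b, 0 < n s)
    (hp : SinConvexOn (Set.Icc a b) p) (hn : SinConcaveOn (Set.Icc (a - κ) b) n)
    (ha : p a ≤ n (a - κ)) (hb : p b ≤ n b) : DominatedBelow p n a b κ := by
  rcases lt_or_ge (n a) (n (a - κ)) with h1 | h1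
  · exact dominatedBelow_of_left hab hκ hw hpc hnc hp0 hn0 hp hn hb h1
  rcases lt_or_ge (n (b - κ)) (n b) with h2 | h2
  swap
  · exact dominatedBelow_of_middle hab hκ hw hpc hnc hp0 hn0 hp hn ha hb h1 h2
  have hm1 : ∀ s ∈ Set.Icc a b, a + b - s ∈ Set.Icc a b := fun s hs =>
    ⟨by linarith [hs.2], by linarith [hs.1]⟩
  have hm2 : ∀ s ∈ Set.Icc (a - κ) b, a + b - κ - s ∈ Set.Icc (a - κ) b := fun s hs =>
    ⟨by linarith [hs.2], by linarith [hs.1]⟩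
  -- Reflecting both intervals in their midpoints exchanges the ends and reduces this case to the
  -- left one.
  obtain ⟨c, hc, h⟩ := dominatedBelow_of_left (p := fun s => p (a + b - s))
    (n := fun s => n (a + b - κ - s)) hab hκ hw
    (hpc.comp (by fun_prop) hm1) (hnc.comp (by fun_prop) hm2)
    (fun s hs => hp0 _ (hm1 s hs)) (fun s hs => hn0 _ (hm2 s hs))
    (fun x hx y hy z hz hxy hyz => by
      have := hp _ (hm1 z hz) _ (hm1 y hy) _ (hm1 x hx) (by linarith) (by linarith)
      simp only [sub_sub_sub_cancel_left] at this
      linarith)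
    (fun x hx y hy z hz hxy hyz => by
      have := hn _ (hm2 z hz) _ (hm2 y hy) _ (hm2 x hx) (by linarith) (by linarith)
      simp only [sub_sub_sub_cancel_left] at this
      linarith)
    (by simpa [show a + b - κ - b = a - κ by ring] using ha)
    (by simpa [show a + b - κ - a = b - κ by ring, show a + b - κ - (a - κ) = b by ring] using h2)
  refine ⟨c, hc, fun f hf hfa hfm hf0 => ?_⟩
  have := h f hf hfa hfm hf0
  rw [intervalIntegral.integral_comp_sub_left (fun s => f (p s)),
    intervalIntegral.integral_comp_sub_left (fun s => f (n s))] at this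
  rwa [show a + b - b = a by ring, show a + b - a = b by ring,
    show a + b - κ - b = a - κ by ring, show a + b - κ - (a - κ) = b by ring] at this

end

/-! ### The weight: spherical area minus a multiple of Euclidean area. -/

/-- The density, with respect to the polar angle, of the difference between the spherical area and
`l` times the Euclidean area of a sector of radius `1 / k` in a tangent plane of the unit sphere. -/
noncomputable def sectorWeight (l k : ℝ) : ℝ := 1 - k / √(1 + k ^ 2) - l / (2 * k ^ 2)

theorem continuousOn_sectorWeight (l : ℝ) : ContinuousOn (sectorWeight l) (Set.Ioi 0) := by
  unfold sectorWeight
  refine ContinuousOn.sub (continuousOn_const.sub (ContinuousOn.div (by fun_prop) (by fun_prop)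
    fun k _ => by positivity)) (ContinuousOn.div (by fun_prop) (by fun_prop) fun k hk => ?_)
  have : 0 < k := hk
  positivity

theorem hasDerivAt_sectorWeight (l : ℝ) {k : ℝ} (hk : 0 < k) :
    HasDerivAt (sectorWeight l) ((l - (k / √(1 + k ^ 2)) ^ 3) / k ^ 3) k := by
  have hq : 0 < 1 + k ^ 2 := by positivity
  have hs : 0 < √(1 + k ^ 2) := by positivity
  have h1 : HasDerivAt (fun k : ℝ => √(1 + k ^ 2)) (2 * k / (2 * √(1 + k ^ 2))) k := by
    refine HasDerivAt.sqrt ?_ hq.ne'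
    simpa using (hasDerivAt_pow 2 k).const_add 1
  have h2 : HasDerivAt (fun k : ℝ => 2 * k ^ 2) (2 * (2 * k)) k := by
    simpa using (hasDerivAt_pow 2 k).const_mul 2
  have h := (((hasDerivAt_id' k).fun_div h1 hs.ne').const_sub 1).sub
    ((hasDerivAt_const k l).fun_div h2 (by positivity))
  refine h.congr_deriv ?_
  have hsq := sq_sqrt hq.le
  set w := √(1 + k ^ 2)
  field_simp
  linear_combination (-2 * k ^ 3) * hsq

theorem div_sqrt_mono {x y : ℝ} (hx : 0 < x) (hxy : x ≤ y) :
    x / √(1 + x ^ 2) ≤ y / √(1 + y ^ 2) := by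
  have hy : 0 < y := by linarith
  rw [div_le_div_iff₀ (by positivity) (by positivity)]
  refine (sq_le_sq₀ (by positivity) (by positivity)).1 ?_
  rw [mul_pow, mul_pow, sq_sqrt (by positivity), sq_sqrt (by positivity)]
  nlinarith [mul_self_le_mul_self hx.le hxy]

/-- The derivative is `(l - (k / √(1 + k²))³) / k³`, and `k / √(1 + k²)` increases; this `l` puts
the change of sign at `c`. -/
theorem sectorWeight_unimodal {c : ℝ} (hc : 0 < c) :
    AntitoneOn (sectorWeight ((c / √(1 + c ^ 2)) ^ 3)) (Set.Ici c) ∧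
      MonotoneOn (sectorWeight ((c / √(1 + c ^ 2)) ^ 3)) (Set.Ioc 0 c) ∧
      ∀ u, c ≤ u → 0 ≤ sectorWeight ((c / √(1 + c ^ 2)) ^ 3) u := by
  set l := (c / √(1 + c ^ 2)) ^ 3 with hl
  refine ⟨?_, ?_, ?_⟩
  · refine antitoneOn_of_deriv_nonpos (convex_Ici c)
      ((continuousOn_sectorWeight l).mono fun x hx => hc.trans_le hx) ?_ ?_
    · intro x hx
      rw [interior_Ici] at hx
      exact (hasDerivAt_sectorWeight l (hc.trans hx)).differentiableAt.differentiableWithinAt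
    · intro x hx
      rw [interior_Ici] at hx
      have hx0 : 0 < x := hc.trans hx
      rw [(hasDerivAt_sectorWeight l hx0).deriv]
      refine div_nonpos_of_nonpos_of_nonneg (sub_nonpos.2 ?_) (by positivity)
      exact pow_le_pow_left₀ (by positivity) (div_sqrt_mono hc (le_of_lt hx)) 3
  · refine monotoneOn_of_deriv_nonneg (convex_Ioc 0 c)
      ((continuousOn_sectorWeight l).mono fun x hx => hx.1) ?_ ?_
    · intro x hx
      rw [interior_Ioc] at hx
      exact (hasDerivAt_sectorWeight l hx.1).differentiableAt.differentiableWithinAt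
    · intro x hx
      rw [interior_Ioc] at hx
      have hx0 : 0 < x := hx.1
      rw [(hasDerivAt_sectorWeight l hx0).deriv]
      refine div_nonneg (sub_nonneg.2 ?_) (by positivity)
      exact pow_le_pow_left₀ (by positivity) (div_sqrt_mono hx0 (le_of_lt hx.2)) 3
  · intro u hu
    have hu0 : 0 < u := hc.trans_le hu
    have h1 : l ≤ (u / √(1 + u ^ 2)) ^ 3 :=
      pow_le_pow_left₀ (by positivity) (div_sqrt_mono hc hu) 3
    have h2 : l / (2 * u ^ 2) ≤ (u / √(1 + u ^ 2)) ^ 3 / (2 * u ^ 2) := by gcongr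
    have hs : 0 < √(1 + u ^ 2) := by positivity
    have hsq : √(1 + u ^ 2) ^ 2 = 1 + u ^ 2 := sq_sqrt (by positivity)
    have h3 : (u / √(1 + u ^ 2)) ^ 3 / (2 * u ^ 2) ≤ 1 - u / √(1 + u ^ 2) := by
      set w := √(1 + u ^ 2)
      have huw : u ≤ w := by nlinarith
      rw [show (u / w) ^ 3 / (2 * u ^ 2) = u / (2 * w ^ 3) by field_simp,
        show 1 - u / w = (w - u) / w by field_simp, div_le_div_iff₀ (by positivity) hs]
      have h4 : (w - u) * (w + u) = 1 := by linear_combination hsq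
      have h5 : u * (w + u) ≤ 2 * w ^ 2 := by nlinarith
      have h6 : u ≤ 2 * w ^ 2 * (w - u) := by
        nlinarith [mul_le_mul_of_nonneg_right h5 (sub_nonneg.2 huw)]
      nlinarith
    unfold sectorWeight
    linarith

/-! ### Spherical area of a polygon from its support numbers. -/

/-- The signed area of the spherical right triangle onto which the planar right triangle with
vertices `(0, 0)`, `(h, 0)`, `(h, x)` is projected from the center of a unit sphere that touches
the plane at the origin. -/
noncomputable def legArea (h x : ℝ) : ℝ :=
  arctan (x / h) - arctan (x / (h * √(1 + (h ^ 2 + x ^ 2))))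

theorem legArea_zero_left (x : ℝ) : legArea 0 x = 0 := by simp [legArea]

theorem legArea_neg (h x : ℝ) : legArea h (-x) = -legArea h x := by
  simp only [legArea, neg_div, arctan_neg, neg_sq]
  ring

/-- This differentiates `legArea` under the dilation by `s` of the planar triangle with legs `h` and
`x`. It turns identities and inequalities for spherical areas into algebraic ones, since everything
is known at `s = 0`. -/
theorem hasDerivAt_arctan_leg (h x s : ℝ) :
    HasDerivAt (fun s => arctan (x / h) - arctan (x / (h * √(1 + s ^ 2 * (h ^ 2 + x ^ 2)))))
      (h * x * s / ((1 + s ^ 2 * h ^ 2) * √(1 + s ^ 2 * (h ^ 2 + x ^ 2)))) s := by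
  rcases eq_or_ne h 0 with rfl | hh
  · simpa using hasDerivAt_const s (0 : ℝ)
  have hq : 0 < 1 + s ^ 2 * (h ^ 2 + x ^ 2) := by positivity
  have hw : 0 < √(1 + s ^ 2 * (h ^ 2 + x ^ 2)) := by positivity
  have h1 : HasDerivAt (fun s : ℝ => √(1 + s ^ 2 * (h ^ 2 + x ^ 2)))
      (2 * s * (h ^ 2 + x ^ 2) / (2 * √(1 + s ^ 2 * (h ^ 2 + x ^ 2)))) s := by
    refine HasDerivAt.sqrt ?_ hq.ne'
    simpa using ((hasDerivAt_pow 2 s).mul_const (h ^ 2 + x ^ 2)).const_add 1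
  have h2 := (((hasDerivAt_const s x).fun_div (h1.const_mul h)
    (mul_ne_zero hh hw.ne')).arctan).const_sub (arctan (x / h))
  refine h2.congr_deriv ?_
  symm
  have hsq := sq_sqrt hq.le
  set w := √(1 + s ^ 2 * (h ^ 2 + x ^ 2))
  have hh2 : 0 < h ^ 2 := by positivity
  have e1 : h ^ 2 * w ^ 2 + x ^ 2 = (h ^ 2 + x ^ 2) * (1 + s ^ 2 * h ^ 2) := by rw [hsq]; ring
  have e2 : 1 + (x / (h * w)) ^ 2 = (h ^ 2 + x ^ 2) * (1 + s ^ 2 * h ^ 2) / (h ^ 2 * w ^ 2) := by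
    rw [← e1]; field_simp
  have hR : 0 < h ^ 2 + x ^ 2 := by positivity
  have hb : 0 < 1 + s ^ 2 * h ^ 2 := by positivity
  rw [e2]
  field_simp
  ring

/-- The side of a spherical triangle whose other two sides have cotangents `h`, `h'` and enclose
the angle `ω`. -/
noncomputable def oppositeSide (h h' ω : ℝ) : ℝ :=
  arccos ((h * h' + cos ω) / √((1 + h ^ 2) * (1 + h' ^ 2)))

theorem hasDerivAt_oppositeSide {h h' ω : ℝ} (hω : ω ∈ Set.Ioo 0 π) (s : ℝ) :
    HasDerivAt (fun s => oppositeSide (s * h) (s * h') ω)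
      (-(h * ((h' - h * cos ω) / sin ω) * s / ((1 + s ^ 2 * h ^ 2) *
          √(1 + s ^ 2 * (h ^ 2 + ((h' - h * cos ω) / sin ω) ^ 2))) +
        h' * ((h - h' * cos ω) / sin ω) * s / ((1 + s ^ 2 * h' ^ 2) *
          √(1 + s ^ 2 * (h' ^ 2 + ((h - h' * cos ω) / sin ω) ^ 2))))) s := by
  have hS : 0 < sin ω := sin_pos_of_pos_of_lt_pi hω.1 hω.2
  have hcs := sin_sq_add_cos_sq ω
  set S := sin ω
  set C := cos ω
  -- The two right triangles share their hypotenuse, the segment from the center to the vertex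
  -- between the two edges.
  have hR : h' ^ 2 + ((h - h' * C) / S) ^ 2 = h ^ 2 + ((h' - h * C) / S) ^ 2 := by
    field_simp
    linear_combination (h' ^ 2 - h ^ 2) * hcs
  rw [hR]
  set q := 1 + s ^ 2 * (h ^ 2 + ((h' - h * C) / S) ^ 2) with hqdef
  have hq : 0 < q := by positivity
  have ha : 0 < 1 + (s * h) ^ 2 := by positivity
  have hb : 0 < 1 + (s * h') ^ 2 := by positivity
  have hab : 0 < (1 + (s * h) ^ 2) * (1 + (s * h') ^ 2) := mul_pos ha hb
  have hw : 0 < √((1 + (s * h) ^ 2) * (1 + (s * h') ^ 2)) := by positivity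
  have hw2 := sq_sqrt hab.le
  have hz : 1 - ((s * h * (s * h') + C) / √((1 + (s * h) ^ 2) * (1 + (s * h') ^ 2))) ^ 2
      = (S * √q / √((1 + (s * h) ^ 2) * (1 + (s * h') ^ 2))) ^ 2 := by
    rw [div_pow, div_pow, mul_pow S, sq_sqrt hq.le, hw2, hqdef]
    field_simp
    linear_combination (-1 - s ^ 2 * h ^ 2) * hcs
  have hpos : 0 < S * √q / √((1 + (s * h) ^ 2) * (1 + (s * h') ^ 2)) := by positivity
  have hlt := sq_lt_one_iff_abs_lt_one _ |>.1
    (show ((s * h * (s * h') + C) / √((1 + (s * h) ^ 2) * (1 + (s * h') ^ 2))) ^ 2 < 1 by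
      nlinarith [pow_pos hpos 2])
  rw [abs_lt] at hlt
  have d1 : HasDerivAt (fun s : ℝ => s * h * (s * h') + C) (2 * s * (h * h')) s := by
    have := ((hasDerivAt_pow 2 s).mul_const (h * h')).add_const C
    refine (this.congr_of_eventuallyEq (Filter.Eventually.of_forall fun u => ?_)).congr_deriv ?_
    · simp only; ring
    · simp
  have dsq : ∀ e : ℝ, HasDerivAt (fun s : ℝ => 1 + (s * e) ^ 2) (2 * s * e ^ 2) s := by
    intro e
    have := ((hasDerivAt_pow 2 s).mul_const (e ^ 2)).const_add 1
    refine (this.congr_of_eventuallyEq (Filter.Eventually.of_forall fun u => ?_)).congr_deriv ?_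
    · simp only; ring
    · simp
  have d2 := ((dsq h).fun_mul (dsq h')).sqrt hab.ne'
  have d3 := (hasDerivAt_arccos hlt.1.ne' hlt.2.ne).comp s (d1.fun_div d2 hw.ne')
  refine d3.congr_deriv ?_
  rw [hz, sqrt_sq hpos.le]
  set w := √((1 + (s * h) ^ 2) * (1 + (s * h') ^ 2))
  have hv : 0 < √q := by positivity
  set v := √q
  have e1 : 1 + s ^ 2 * h ^ 2 = 1 + (s * h) ^ 2 := by ring
  have e2 : 1 + s ^ 2 * h' ^ 2 = 1 + (s * h') ^ 2 := by ring
  rw [e1, e2]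
  set a := 1 + (s * h) ^ 2 with hadef
  set b := 1 + (s * h') ^ 2 with hbdef
  have key : 2 * s * (h * h') * (a * b)
      - (s * h * (s * h') + C) * (2 * s * h ^ 2 * b + a * (2 * s * h' ^ 2)) / 2
      = s * (h * (h' - h * C) * b + h' * (h - h' * C) * a) := by
    rw [hadef, hbdef]; ring
  have e3 : (2 * s * (h * h') * w - (s * h * (s * h') + C) *
      ((2 * s * h ^ 2 * b + a * (2 * s * h' ^ 2)) / (2 * w))) / w ^ 2
      = s * (h * (h' - h * C) * b + h' * (h - h' * C) * a) / (w * (a * b)) := by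
    rw [← key, hw2]
    field_simp
    rw [hw2]
    ring
  rw [e3]
  field_simp

/-- The angle excess of a quadrilateral with angle `ω` at the center, two right angles, and a fourth
angle supplementary to the polar side. The derivatives of both areas and of the side cancel under
dilation, and at `s = 0` only `ω` remains. -/
theorem legArea_add_legArea {h h' ω : ℝ} (hω : ω ∈ Set.Ioo 0 π) :
    legArea h ((h' - h * cos ω) / sin ω) + legArea h' ((h - h' * cos ω) / sin ω)
      = ω - oppositeSide h h' ω := by
  set x := (h' - h * cos ω) / sin ω
  set y := (h - h' * cos ω) / sin ω
  have hd : ∀ s, HasDerivAt (fun s =>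
      (arctan (x / h) - arctan (x / (h * √(1 + s ^ 2 * (h ^ 2 + x ^ 2))))) +
      (arctan (y / h') - arctan (y / (h' * √(1 + s ^ 2 * (h' ^ 2 + y ^ 2))))) +
      oppositeSide (s * h) (s * h') ω) 0 s := fun s => by
    refine (((hasDerivAt_arctan_leg h x s).add (hasDerivAt_arctan_leg h' y s)).add
      (hasDerivAt_oppositeSide hω s)).congr_deriv ?_
    exact add_neg_cancel _
  have := is_const_of_deriv_eq_zero (fun s => (hd s).differentiableAt) (fun s => (hd s).deriv) 1 0
  simp only [one_pow, one_mul, ne_eq, OfNat.ofNat_ne_zero, not_false_eq_true, zero_pow, zero_mul,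
    add_zero, sqrt_one, mul_one, sub_self, zero_add] at this
  have h0 : oppositeSide 0 0 ω = ω := by
    simp [oppositeSide, arccos_cos hω.1.le hω.2.le]
  rw [h0] at this
  unfold legArea
  linarith

theorem strictMono_div_sqrt {c d : ℝ} (hc : 0 < c) (hd : 0 ≤ d) :
    StrictMono fun x : ℝ => x / √(c + d * x ^ 2) := by
  refine strictMono_of_deriv_pos fun x => ?_
  have hq : 0 < c + d * x ^ 2 := by positivity
  have hw : 0 < √(c + d * x ^ 2) := by positivity
  have h1 : HasDerivAt (fun x : ℝ => c + d * x ^ 2) (d * (2 * x)) x := by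
    simpa using ((hasDerivAt_pow 2 x).const_mul d).const_add c
  have h2 := (hasDerivAt_id' x).fun_div (h1.sqrt hq.ne') hw.ne'
  rw [h2.deriv]
  refine div_pos ?_ (by positivity)
  have hsq := sq_sqrt hq.le
  set w := √(c + d * x ^ 2)
  rw [show 1 * w - x * (d * (2 * x) / (2 * w)) = c / w by field_simp; linear_combination hsq]
  positivity

/-- Oddness and monotonicity of `x / √(c + d x²)`. It serves twice: for the sign of the spherical
area over an edge, and to translate convexity at a boundary edge into a nonnegative dual edge
length. -/
theorem div_sqrt_add_nonneg_iff {c d : ℝ} (hc : 0 < c) (hd : 0 ≤ d) (x y : ℝ) :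
    0 ≤ x / √(c + d * x ^ 2) + y / √(c + d * y ^ 2) ↔ 0 ≤ x + y := by
  have h := (strictMono_div_sqrt hc hd).le_iff_le (a := -y) (b := x)
  simp only [neg_sq, neg_div] at h
  constructor
  · intro h1
    linarith [h.1 (by linarith)]
  · intro h1
    linarith [h.2 (by linarith)]

theorem legArea_add_nonpos {h x y : ℝ} (hh : h ≤ 0) (hxy : 0 ≤ x + y) :
    legArea h x + legArea h y ≤ 0 := by
  have hd := fun s => (hasDerivAt_arctan_leg h x s).fun_add (hasDerivAt_arctan_leg h y s)
  have hanti := antitoneOn_of_deriv_nonpos (convex_Ici (0 : ℝ))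
    (fun s _ => (hd s).continuousAt.continuousWithinAt)
    (fun s _ => (hd s).differentiableAt.differentiableWithinAt) (fun s hs => by
      rw [interior_Ici] at hs
      have hs0 : 0 < s := hs
      rw [(hd s).deriv]
      have hb : 0 < 1 + s ^ 2 * h ^ 2 := by positivity
      have h1 := (div_sqrt_add_nonneg_iff hb (sq_nonneg s) x y).2 hxy
      simp only [add_assoc, ← mul_add] at h1
      have h2 : h * s / (1 + s ^ 2 * h ^ 2) ≤ 0 :=
        div_nonpos_of_nonpos_of_nonneg (mul_nonpos_of_nonpos_of_nonneg hh hs0.le) hb.le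
      refine le_of_eq_of_le ?_ (mul_nonpos_of_nonpos_of_nonneg h2 h1)
      rw [mul_add (h * s / _), div_mul_div_comm, div_mul_div_comm]
      ring)
  have := hanti (Set.mem_Ici.2 le_rfl) (Set.mem_Ici.2 zero_le_one) zero_le_one
  simpa [legArea] using this

/-! ### Weighted areas as integrals over the polar angle. -/

/-- The difference between the spherical area and `l` times the Euclidean area of the right triangle
with legs `h` and `x`. -/
noncomputable def legWeight (l h x : ℝ) : ℝ := legArea h x - l * (h * x / 2)

/-- Here `cos (s - t) / h` is the inverse radius of the line with normal direction `t` and signed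
support number `h`; positivity selects the directions that meet the line, also for negative `h`. -/
theorem hasDerivAt_sector_primitive (l : ℝ) {h t s : ℝ} (hk : 0 < cos (s - t) / h) :
    HasDerivAt (fun s => arctan (tan (s - t))
        - arctan (sin (s - t) / (h * √(1 + (cos (s - t) / h) ^ 2)))
        - l * (h ^ 2 / 2 * tan (s - t)))
      (sectorWeight l (cos (s - t) / h)) s := by
  have hc : cos (s - t) ≠ 0 := by
    rintro h0; simp [h0] at hk
  have hh : h ≠ 0 := by
    rintro rfl; simp at hk
  have hid : HasDerivAt (fun s : ℝ => s - t) 1 s := (hasDerivAt_id' s).sub_const t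
  have htan : HasDerivAt (fun s => tan (s - t)) (1 / cos (s - t) ^ 2) s := by
    have := (hasDerivAt_tan hc).comp s hid
    rwa [mul_one] at this
  have hcos : HasDerivAt (fun s => cos (s - t)) (-sin (s - t)) s := by
    simpa using hid.cos
  have hsin : HasDerivAt (fun s => sin (s - t)) (cos (s - t)) s := by
    simpa using hid.sin
  have hq : 0 < 1 + (cos (s - t) / h) ^ 2 := by positivity
  have hw : 0 < √(1 + (cos (s - t) / h) ^ 2) := by positivity
  have hsq := sq_sqrt hq.le
  have d1 := (((hcos.div_const h).fun_pow 2).const_add 1).sqrt hq.ne'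
  have d2 := (hsin.fun_div (d1.const_mul h) (mul_ne_zero hh hw.ne')).arctan
  refine ((htan.arctan.sub d2).sub ((htan.const_mul (h ^ 2 / 2)).const_mul l)).congr_deriv ?_
  have hcs := sin_sq_add_cos_sq (s - t)
  unfold sectorWeight
  set w := √(1 + (cos (s - t) / h) ^ 2)
  have e1 : 1 + tan (s - t) ^ 2 = 1 / cos (s - t) ^ 2 := by
    rw [tan_eq_sin_div_cos]; field_simp; linear_combination hcs
  have hw2 : h ^ 2 * w ^ 2 = h ^ 2 + cos (s - t) ^ 2 := by rw [hsq]; field_simp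
  have e2 : 1 + (sin (s - t) / (h * w)) ^ 2 = (1 + h ^ 2) / (h ^ 2 * w ^ 2) := by
    rw [div_pow, mul_pow, hw2]
    have : 0 < h ^ 2 + cos (s - t) ^ 2 := by positivity
    field_simp
    linear_combination hcs
  have e3 : (cos (s - t) * (h * w) - sin (s - t) * (h * (((2 : ℕ) : ℝ) * (cos (s - t) / h) ^ (2 - 1)
      * (-sin (s - t) / h) / (2 * w)))) / (h * w) ^ 2
      = cos (s - t) * (1 + h ^ 2) / (h ^ 3 * w ^ 3) := by
    simp only [Nat.cast_ofNat, Nat.add_one_sub_one, pow_one]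
    field_simp
    rw [hw2]
    linear_combination hcs
  rw [e1, e2, e3]
  have : 0 < 1 + h ^ 2 := by positivity
  field_simp

theorem IsSinusoid.pos_of_ends_of_lt {g : ℝ → ℝ} (hg : IsSinusoid g) {x y z : ℝ} (hxy : x ≤ y)
    (hyz : y < z) (hzx : z - x < π) (hx : 0 < g x) (hz : 0 ≤ g z) : 0 < g y := by
  have h := hg.three_point x y z
  have h1 : 0 < sin (z - y) := sin_pos_of_pos_of_lt_pi (by linarith) (by linarith)
  have h2 : 0 ≤ sin (y - x) := sin_nonneg_of_nonneg_of_le_pi (by linarith) (by linarith)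
  have h3 : 0 < sin (z - x) := sin_pos_of_pos_of_lt_pi (by linarith) hzx
  have := add_pos_of_pos_of_nonneg (mul_pos hx h1) (mul_nonneg hz h2)
  rw [← h] at this
  exact pos_of_mul_pos_left this h3.le

theorem sinConvexOn_sup' {ι : Type*} {s : Finset ι} (hs : s.Nonempty) {g : ι → ℝ → ℝ}
    (hg : ∀ i, IsSinusoid (g i)) {a b : ℝ} (hab : b - a < π) :
    SinConvexOn (Set.Icc a b) fun u => s.sup' hs fun i => g i u := by
  intro x hx y hy z hz hxy hyz
  obtain ⟨i, hi, h⟩ := s.exists_mem_eq_sup' hs fun i => g i y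
  have h1 : 0 ≤ sin (z - y) :=
    sin_nonneg_of_nonneg_of_le_pi (by linarith) (by linarith [hz.2, hy.1])
  have h2 : 0 ≤ sin (y - x) :=
    sin_nonneg_of_nonneg_of_le_pi (by linarith) (by linarith [hy.2, hx.1])
  simp only [h]
  rw [(hg i).three_point x y z]
  exact add_le_add
    (mul_le_mul_of_nonneg_right (s.le_sup' (fun i => g i x) hi) h1)
    (mul_le_mul_of_nonneg_right (s.le_sup' (fun i => g i z) hi) h2)

theorem sinConcaveOn_inf' {ι : Type*} {s : Finset ι} (hs : s.Nonempty) {g : ι → ℝ → ℝ}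
    (hg : ∀ i, IsSinusoid (g i)) {a b : ℝ} (hab : b - a < π) :
    SinConcaveOn (Set.Icc a b) fun u => s.inf' hs fun i => g i u := by
  intro x hx y hy z hz hxy hyz
  obtain ⟨i, hi, h⟩ := s.exists_mem_eq_inf' hs fun i => g i y
  have h1 : 0 ≤ sin (z - y) :=
    sin_nonneg_of_nonneg_of_le_pi (by linarith) (by linarith [hz.2, hy.1])
  have h2 : 0 ≤ sin (y - x) :=
    sin_nonneg_of_nonneg_of_le_pi (by linarith) (by linarith [hy.2, hx.1])
  simp only [h]
  rw [(hg i).three_point x y z]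
  exact add_le_add
    (mul_le_mul_of_nonneg_right (s.inf'_le (fun i => g i x) hi) h1)
    (mul_le_mul_of_nonneg_right (s.inf'_le (fun i => g i z) hi) h2)

theorem sector_primitive_eq (l : ℝ) {H x t R θ : ℝ} (hR : 0 < R)
    (h1 : R * cos (θ - t) = H) (h2 : R * sin (θ - t) = x) :
    arctan (tan (θ - t)) - arctan (sin (θ - t) / (H * √(1 + (cos (θ - t) / H) ^ 2)))
        - l * (H ^ 2 / 2 * tan (θ - t)) = legWeight l H x := by
  rcases eq_or_ne H 0 with rfl | hH
  · have hc : cos (θ - t) = 0 := by simpa [hR.ne'] using h1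
    simp [legWeight, legArea, tan_eq_sin_div_cos, hc]
  have hc : cos (θ - t) ≠ 0 := by
    rintro h0; rw [h0, mul_zero] at h1; exact hH h1.symm
  have e1 : tan (θ - t) = x / H := by
    rw [tan_eq_sin_div_cos, ← h1, ← h2, mul_div_mul_left _ _ hR.ne']
  have e2 : cos (θ - t) / H = 1 / R := by
    rw [← h1]; field_simp
  have e3 : H ^ 2 + x ^ 2 = R ^ 2 := by
    rw [← h1, ← h2]; linear_combination R ^ 2 * sin_sq_add_cos_sq (θ - t)
  have e4 : √(1 + R ^ 2) = R * √(1 + (1 / R) ^ 2) := by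
    rw [show 1 + R ^ 2 = R ^ 2 * (1 + (1 / R) ^ 2) by field_simp; ring,
      sqrt_mul (sq_nonneg R), sqrt_sq hR.le]
  have e5 : sin (θ - t) / (H * √(1 + (1 / R) ^ 2)) = x / (H * √(1 + (H ^ 2 + x ^ 2))) := by
    rw [e3, e4, ← h2]
    have : 0 < √(1 + (1 / R) ^ 2) := by positivity
    field_simp
  rw [e2, e5, e1, legWeight, legArea]
  field_simp

/-- The weighted area of the triangle over an edge, in polar coordinates. -/
theorem integral_sectorWeight_edge (l : ℝ) {H x y t R R' θ θ' : ℝ} (hH : H ≠ 0) (hR : 0 < R)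
    (hR' : 0 < R') (hθ : |θ - θ'| < π) (h1 : R * cos (θ - t) = H) (h2 : R * sin (θ - t) = x)
    (h3 : R' * cos (θ' - t) = H) (h4 : R' * sin (θ' - t) = -y) :
    ∫ s in θ'..θ, sectorWeight l (cos (s - t) / H) = legWeight l H x + legWeight l H y := by
  rw [abs_lt] at hθ
  have hs := IsSinusoid.cos_sub_div t H
  have p1 : 0 < cos (θ - t) / H := by
    rw [show cos (θ - t) / H = 1 / R by
      rw [← h1] at hH ⊢
      have := right_ne_zero_of_mul hH
      field_simp]
    positivity
  have p2 : 0 < cos (θ' - t) / H := by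
    rw [show cos (θ' - t) / H = 1 / R' by
      rw [← h3] at hH ⊢
      have := right_ne_zero_of_mul hH
      field_simp]
    positivity
  have hpos : ∀ s ∈ Set.uIcc θ' θ, 0 < cos (s - t) / H := by
    intro s hs'
    rcases le_total θ' θ with h | h
    · rw [Set.uIcc_of_le h] at hs'
      exact hs.pos_of_ends hs'.1 hs'.2 (by linarith) p2 p1
    · rw [Set.uIcc_of_ge h] at hs'
      exact hs.pos_of_ends hs'.1 hs'.2 (by linarith) p1 p2
  have hcont : ContinuousOn (fun s => sectorWeight l (cos (s - t) / H)) (Set.uIcc θ' θ) :=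
    (continuousOn_sectorWeight l).comp hs.continuous.continuousOn hpos
  rw [intervalIntegral.integral_eq_sub_of_hasDerivAt
    (fun s hs' => hasDerivAt_sector_primitive l (hpos s hs')) hcont.intervalIntegrable,
    sector_primitive_eq l hR h1 h2, sector_primitive_eq l hR' h3 h4]
  simp only [legWeight, legArea_neg]
  ring

/-! ### Polygons given by support numbers. -/

/-- The sequence of support numbers `H` of a polygon that is convex along its boundary, with the
angles `ω` between successive normals. The polygon closes up after `m` steps, up to the rotation
by the total angle, which is less than `2π`. -/
structure SupportChain where
  m : ℕ
  H : ℕ → ℝ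
  ω : ℕ → ℝ
  ω_mem : ∀ k, ω k ∈ Set.Ioo 0 π
  H_add : ∀ k, H (k + m) = H k
  ω_add : ∀ k, ω (k + m) = ω k
  len_nonneg : ∀ k, 0 ≤ (H (k + 2) - H (k + 1) * cos (ω (k + 1))) / sin (ω (k + 1))
    + (H k - H (k + 1) * cos (ω k)) / sin (ω k)
  total_lt : ∑ k ∈ Finset.range m, ω k < 2 * π

namespace SupportChain

variable (C : SupportChain)

/-- The part of the `k`-th edge after the foot of its normal. -/
noncomputable def fwd (k : ℕ) : ℝ := (C.H (k + 1) - C.H k * cos (C.ω k)) / sin (C.ω k)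

/-- The part of the `k + 1`-st edge before the foot of its normal. -/
noncomputable def bwd (k : ℕ) : ℝ := (C.H k - C.H (k + 1) * cos (C.ω k)) / sin (C.ω k)

/-- The length of the `k + 1`-st edge. -/
noncomputable def len (k : ℕ) : ℝ := C.fwd (k + 1) + C.bwd k

theorem len_nonneg' (k : ℕ) : 0 ≤ C.len k := C.len_nonneg k

/-- The direction of the `k`-th normal. -/
noncomputable def t (k : ℕ) : ℝ := ∑ i ∈ Finset.range k, C.ω i

/-- The support function of the vertex between the `k`-th and the `k + 1`-st edge. -/
noncomputable def σ (k : ℕ) (s : ℝ) : ℝ := C.H k * cos (s - C.t k) + C.fwd k * sin (s - C.t k)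

theorem sin_ω_pos (k : ℕ) : 0 < sin (C.ω k) :=
  sin_pos_of_pos_of_lt_pi (C.ω_mem k).1 (C.ω_mem k).2

theorem t_zero : C.t 0 = 0 := by simp [t]

theorem t_succ (k : ℕ) : C.t (k + 1) = C.t k + C.ω k := by simp [t, Finset.sum_range_succ]

theorem t_strictMono : StrictMono C.t :=
  strictMono_nat_of_lt_succ fun k => by rw [t_succ]; linarith [(C.ω_mem k).1]

theorem t_le {i j : ℕ} (h : i ≤ j) : C.t i ≤ C.t j := C.t_strictMono.monotone h

theorem t_nonneg (i : ℕ) : 0 ≤ C.t i := by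
  rw [← C.t_zero]; exact C.t_le (Nat.zero_le i)

theorem t_m_lt : C.t C.m < 2 * π := C.total_lt

theorem isSinusoid_σ (k : ℕ) : IsSinusoid (C.σ k) :=
  ⟨C.H k * cos (C.t k) - C.fwd k * sin (C.t k), C.H k * sin (C.t k) + C.fwd k * cos (C.t k),
    fun s => by rw [σ, cos_sub, sin_sub]; ring⟩

theorem σ_self (k : ℕ) : C.σ k (C.t k) = C.H k := by simp [σ]

theorem σ_eq (k : ℕ) (s : ℝ) :
    C.σ k s = C.H (k + 1) * cos (s - C.t (k + 1)) - C.bwd k * sin (s - C.t (k + 1)) := by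
  have h := (C.sin_ω_pos k).ne'
  have e : s - C.t k = s - C.t (k + 1) + C.ω k := by rw [t_succ]; ring
  rw [σ, e, cos_add, sin_add, fwd, bwd]
  set u := s - C.t (k + 1)
  field_simp
  linear_combination (-(C.H k * sin u)) * sin_sq_add_cos_sq (C.ω k)

theorem σ_succ_self (k : ℕ) : C.σ k (C.t (k + 1)) = C.H (k + 1) := by simp [σ_eq]

/-- From one vertex to the next the polygon moves by `len` along the edge, perpendicular to its
normal. Since `len ≥ 0`, the sign of the sine decides how support functions of successive vertices
compare. -/
theorem σ_succ (k : ℕ) (s : ℝ) :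
    C.σ (k + 1) s = C.σ k s + C.len k * sin (s - C.t (k + 1)) := by
  rw [C.σ_eq k s, σ, len]; ring

theorem σ_add_pi (k : ℕ) (s : ℝ) : C.σ k (s + π) = -C.σ k s := by
  rw [σ, σ, add_sub_right_comm, cos_add_pi, sin_add_pi]; ring

theorem σ_sub_pi (k : ℕ) (s : ℝ) : C.σ k (s - π) = -C.σ k s := by
  rw [σ, σ, sub_right_comm, cos_sub_pi, sin_sub_pi]; ring

theorem σ_sub_two_pi (k : ℕ) (s : ℝ) : C.σ k (s - 2 * π) = C.σ k s := by
  rw [σ, σ, sub_right_comm, cos_sub_two_pi, sin_sub_two_pi]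

theorem H_m : C.H C.m = C.H 0 := by simpa using C.H_add 0

theorem fwd_m : C.fwd C.m = C.fwd 0 := by
  have h1 := C.H_add 1
  have h2 := C.ω_add 0
  rw [add_comm 1] at h1
  rw [zero_add] at h2
  rw [fwd, fwd, h1, h2, H_m]

/-- The last vertex is the first one rotated by the total angle; the polygon closes only up to this
rotation. -/
theorem σ_m (s : ℝ) : C.σ C.m s = C.σ 0 (s - C.t C.m) := by
  rw [σ, σ, H_m, fwd_m, t_zero, sub_zero]

theorem σ_le_of_sin_nonneg {j k : ℕ} (hjk : j ≤ k) {s : ℝ}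
    (h : ∀ i, j < i → i ≤ k → 0 ≤ sin (s - C.t i)) : C.σ j s ≤ C.σ k s := by
  induction k, hjk using Nat.le_induction with
  | base => exact le_rfl
  | succ k hjk ih =>
    refine (ih fun i h1 h2 => h i h1 (by lia)).trans ?_
    rw [σ_succ]
    linarith [mul_nonneg (C.len_nonneg' k) (h (k + 1) (by lia) le_rfl)]

theorem σ_le_of_sin_nonpos {j k : ℕ} (hjk : j ≤ k) {s : ℝ}
    (h : ∀ i, j < i → i ≤ k → sin (s - C.t i) ≤ 0) : C.σ k s ≤ C.σ j s := by
  induction k, hjk using Nat.le_induction with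
  | base => exact le_rfl
  | succ k hjk ih =>
    refine le_trans ?_ (ih fun i h1 h2 => h i h1 (by lia))
    rw [σ_succ]
    linarith [mul_nonneg (C.len_nonneg' k) (neg_nonneg.2 (h (k + 1) (by lia) le_rfl))]

/-- The angular excess of the polygon. -/
noncomputable def excess : ℝ :=
  ∑ k ∈ Finset.range C.m, (C.ω k - oppositeSide (C.H k) (C.H (k + 1)) (C.ω k))

/-- The excess is regrouped from vertices to edges; periodicity makes up for the shift of the index.
-/
theorem excess_eq : C.excess = ∑ k ∈ Finset.range C.m,
    (legArea (C.H (k + 1)) (C.fwd (k + 1)) + legArea (C.H (k + 1)) (C.bwd k)) := by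
  have h1 : C.excess = ∑ k ∈ Finset.range C.m, legArea (C.H k) (C.fwd k)
      + ∑ k ∈ Finset.range C.m, legArea (C.H (k + 1)) (C.bwd k) := by
    rw [← Finset.sum_add_distrib, excess]
    exact Finset.sum_congr rfl fun k _ => (legArea_add_legArea (C.ω_mem k)).symm
  have h2 := Finset.sum_range_succ (fun k => legArea (C.H k) (C.fwd k)) C.m
  rw [Finset.sum_range_succ', C.H_m, C.fwd_m] at h2
  rw [h1, Finset.sum_add_distrib, add_right_cancel h2]

end SupportChain

/-! ### Chains with a sign change: position of the vertices. -/

theorem sin_nonneg_of_neg_two_pi_le {u : ℝ} (h1 : -(2 * π) ≤ u) (h2 : u ≤ -π) : 0 ≤ sin u := by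
  rw [← sin_add_two_pi]
  exact sin_nonneg_of_nonneg_of_le_pi (by linarith) (by linarith)

theorem sin_nonpos_of_pi_le {u : ℝ} (h1 : π ≤ u) (h2 : u ≤ 2 * π) : sin u ≤ 0 := by
  rw [← sin_sub_two_pi]
  exact sin_nonpos_of_nonpos_of_neg_pi_le (by linarith) (by linarith)

/-- A chain whose support numbers change their sign from `0` to `1`. The first `N` are positive,
the next one is not, and `H q` is negative. -/
structure MixedChain extends SupportChain where
  N : ℕ
  q : ℕ
  H_zero : H 0 ≤ 0
  N_pos : 0 < N
  H_pos : ∀ i, 0 < i → i ≤ N → 0 < H i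
  H_N_succ : H (N + 1) ≤ 0
  N_lt : N < m
  q_gt : N < q
  q_le : q ≤ m
  H_q : H q < 0

namespace MixedChain

variable (C : MixedChain)

theorem H_one_pos : 0 < C.H 1 := C.H_pos 1 one_pos C.N_pos

theorem t_lt_two_pi {i : ℕ} (hi : i ≤ C.m) : C.t i < 2 * π := (C.t_le hi).trans_lt C.t_m_lt

/-- Otherwise the support function of vertex `0` would be nonpositive at both ends of an arc shorter
than `π`, hence also at `t 1`, where it equals `H 1 > 0`. As the total angle is below `2π`, the
block after `N` spans less than `π`. -/
theorem pi_le_t : π ≤ C.t (C.N + 1) := by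
  by_contra! h
  have h1 : C.σ 0 (C.t (C.N + 1)) ≤ 0 := by
    refine (C.σ_le_of_sin_nonneg (Nat.zero_le (C.N + 1)) fun i _ hi => ?_).trans
      ((C.σ_self _).le.trans C.H_N_succ)
    exact sin_nonneg_of_nonneg_of_le_pi (by linarith [C.t_le hi]) (by linarith [C.t_nonneg i])
  have h2 := (C.isSinusoid_σ 0).neg.nonneg_of_ends (C.t_le zero_le_one)
    (C.t_le (show 1 ≤ C.N + 1 by lia)) (by rw [C.t_zero]; linarith)
    (by rw [C.σ_self]; linarith [C.H_zero]) (by linarith)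
  have h3 := C.σ_succ_self 0
  rw [zero_add] at h3
  linarith [C.H_one_pos]

theorem t_sub_lt {i j : ℕ} (hi : C.N < i) (hj : j ≤ C.m) : C.t j - C.t i < π := by
  have h1 := C.t_le (show C.N + 1 ≤ i from hi)
  linarith [C.pi_le_t, C.t_lt_two_pi hj]

/-- The normals of this block span less than `π`, so local convexity is global: its vertices lie on
the inner side of all its edge lines. -/
theorem σ_le_of_nonpos_block {j l : ℕ} (hj : C.N ≤ j) (hj' : j ≤ C.m) (hl : C.N < l)
    (hl' : l ≤ C.m) : C.σ j (C.t l) ≤ C.H l := by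
  rw [← C.σ_self l]
  rcases le_total j l with h | h
  · refine C.σ_le_of_sin_nonneg h fun i hi hi' => ?_
    exact sin_nonneg_of_nonneg_of_le_pi (by linarith [C.t_le hi'])
      (C.t_sub_lt (by lia) hl').le
  · refine C.σ_le_of_sin_nonpos h fun i hi hi' => ?_
    exact sin_nonpos_of_nonpos_of_neg_pi_le (by linarith [C.t_le hi.le])
      (by linarith [C.t_sub_lt hl (show i ≤ C.m by lia)])

/-- The support function of vertex `l` is nonpositive at both ends of the block, which is shorter
than `π`. So there is only one block of positive support numbers. -/
theorem H_nonpos {l : ℕ} (hl : C.N < l) (hl' : l ≤ C.m) : C.H l ≤ 0 := by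
  have h1 := C.σ_le_of_nonpos_block hl.le hl' (Nat.lt_succ_self _) C.N_lt
  have h2 := C.σ_le_of_nonpos_block hl.le hl' C.N_lt le_rfl
  have h := (C.isSinusoid_σ l).neg.nonneg_of_ends (C.t_le hl) (C.t_le hl')
    (C.t_sub_lt (Nat.lt_succ_self _) le_rfl)
    (by linarith [C.H_N_succ]) (by rw [C.H_m] at h2; linarith [C.H_zero])
  rw [C.σ_self] at h
  linarith

theorem σ_zero_neg {s : ℝ} (h1 : C.t 1 + π ≤ s) (h2 : s < 2 * π) : C.σ 0 s < 0 := by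
  have h := (C.isSinusoid_σ 0).neg.pos_of_ends_of_lt h1 h2
    (by linarith [C.t_strictMono one_pos, C.t_zero])
    (by have := C.σ_succ_self 0; rw [zero_add] at this
        rw [C.σ_add_pi]; linarith [C.H_one_pos])
    (by have := C.σ_self 0; rw [C.t_zero] at this
        rw [← C.σ_sub_two_pi, sub_self]; linarith [C.H_zero])
  linarith

theorem σ_N_nonpos {s : ℝ} (h1 : C.t (C.N + 1) - 2 * π ≤ s) (h2 : s ≤ C.t C.N - π) :
    C.σ C.N s ≤ 0 := by
  have h := (C.isSinusoid_σ C.N).neg.nonneg_of_ends h1 h2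
    (by linarith [C.t_strictMono (Nat.lt_succ_self C.N)])
    (by rw [C.σ_sub_two_pi, C.σ_succ_self]; linarith [C.H_N_succ])
    (by rw [C.σ_sub_pi, C.σ_self]; linarith [C.H_pos C.N C.N_pos le_rfl])
  linarith

/-- Local convexity suffices for normals at most `π` apart. For larger gaps one compares with an end
vertex of the block, whose support function is nonpositive there while `H l > 0`. -/
theorem σ_le_of_pos_block {j l : ℕ} (hj : j ≤ C.N) (hl : 0 < l) (hl' : l ≤ C.N) :
    C.σ j (C.t l) ≤ C.H l := by
  have hN := C.N_lt
  rcases lt_or_ge j l with h | h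
  · rcases le_total (C.t l - C.t (j + 1)) π with hd | hd
    · rw [← C.σ_self l]
      refine C.σ_le_of_sin_nonneg h.le fun i hi hi' => ?_
      exact sin_nonneg_of_nonneg_of_le_pi (by linarith [C.t_le hi'])
        (by linarith [C.t_le (show j + 1 ≤ i from hi)])
    · have h2π := C.t_lt_two_pi (show l ≤ C.m by lia)
      have h1 : C.σ j (C.t l) ≤ C.σ 0 (C.t l) := by
        refine C.σ_le_of_sin_nonpos (Nat.zero_le j) fun i hi hi' => ?_
        exact sin_nonpos_of_pi_le (by linarith [C.t_le (show i ≤ j + 1 by lia)])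
          (by linarith [C.t_nonneg i])
      have h2 := C.σ_zero_neg (by linarith [C.t_le (show 1 ≤ j + 1 by lia)]) h2π
      linarith [C.H_pos l hl hl']
  · rcases le_total (C.t j - C.t l) π with hd | hd
    · rw [← C.σ_self l]
      refine C.σ_le_of_sin_nonpos h fun i hi hi' => ?_
      exact sin_nonpos_of_nonpos_of_neg_pi_le (by linarith [C.t_le hi.le])
        (by linarith [C.t_le hi'])
    · have h2π := C.t_lt_two_pi (show C.N + 1 ≤ C.m by lia)
      have h1 : C.σ j (C.t l) ≤ C.σ C.N (C.t l) := by
        refine C.σ_le_of_sin_nonneg hj fun i hi hi' => ?_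
        exact sin_nonneg_of_neg_two_pi_le
          (by linarith [C.t_nonneg l, C.t_le (show i ≤ C.N + 1 by lia)])
          (by linarith [C.t_le hi.le])
      have h2 := C.σ_N_nonpos (s := C.t l) (by linarith [C.t_nonneg l]) (by linarith [C.t_le hj])
      linarith [C.H_pos l hl hl']

/-- All vertices lie in the open half plane opposite to the normal of an edge with negative support
number. Hence polar angles can be chosen in one half circle, without ambiguity modulo `2π`. -/
theorem σ_t_q_neg {k : ℕ} (hk : k ≤ C.m) : C.σ k (C.t C.q) < 0 := by
  have hq := C.H_q
  have hqN := C.q_gt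
  have hN : C.σ C.N (C.t C.q) < 0 :=
    (C.σ_le_of_nonpos_block le_rfl C.N_lt.le C.q_gt C.q_le).trans_lt hq
  rcases le_or_gt C.N k with h | h
  · exact (C.σ_le_of_nonpos_block h hk C.q_gt C.q_le).trans_lt hq
  · rcases le_total (C.t C.q - C.t (k + 1)) π with hd | hd
    · refine (C.σ_le_of_sin_nonneg h.le fun i hi hi' => ?_).trans_lt hN
      exact sin_nonneg_of_nonneg_of_le_pi (by linarith [C.t_le (hi'.trans hqN.le)])
        (by linarith [C.t_le (show k + 1 ≤ i from hi)])
    · have h2π := C.t_lt_two_pi C.q_le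
      refine (C.σ_le_of_sin_nonpos (Nat.zero_le k) fun i hi hi' => ?_).trans_lt
        (C.σ_zero_neg (by linarith [C.t_le (show 1 ≤ k + 1 by lia)]) h2π)
      exact sin_nonpos_of_pi_le (by linarith [C.t_le (show i ≤ k + 1 by lia)])
        (by linarith [C.t_nonneg i])

theorem exists_polar : ∃ R θ : ℕ → ℝ, ∀ k, k ≤ C.m → 0 < R k ∧
    |θ k - (C.t C.q - π)| < π / 2 ∧ ∀ s, C.σ k s = R k * cos (s - θ k) := by
  have h : ∀ k, ∃ R θ : ℝ, k ≤ C.m → 0 < R ∧ |θ - (C.t C.q - π)| < π / 2 ∧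
      ∀ s, C.σ k s = R * cos (s - θ) := by
    intro k
    by_cases hk : k ≤ C.m
    · obtain ⟨R, θ, h⟩ := (C.isSinusoid_σ k).exists_polar (φ := C.t C.q - π)
        (by rw [C.σ_sub_pi]; linarith [C.σ_t_q_neg hk])
      exact ⟨R, θ, fun _ => h⟩
    · exact ⟨0, 0, fun h => absurd h hk⟩
  choose R θ h using h
  exact ⟨R, θ, h⟩

/-- The distance of the vertex after the `k`-th edge from the center. -/
noncomputable def R : ℕ → ℝ := C.exists_polar.choose

/-- The direction of the vertex after the `k`-th edge. -/
noncomputable def θ : ℕ → ℝ := C.exists_polar.choose_spec.choose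

theorem R_pos {k : ℕ} (hk : k ≤ C.m) : 0 < C.R k :=
  (C.exists_polar.choose_spec.choose_spec k hk).1

theorem abs_θ {k : ℕ} (hk : k ≤ C.m) : |C.θ k - (C.t C.q - π)| < π / 2 :=
  (C.exists_polar.choose_spec.choose_spec k hk).2.1

theorem σ_eq_polar {k : ℕ} (hk : k ≤ C.m) (s : ℝ) : C.σ k s = C.R k * cos (s - C.θ k) :=
  (C.exists_polar.choose_spec.choose_spec k hk).2.2 s

theorem θ_sub_lt {j k : ℕ} (hj : j ≤ C.m) (hk : k ≤ C.m) : C.θ j - C.θ k < π := by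
  have h1 := abs_lt.1 (C.abs_θ hj)
  have h2 := abs_lt.1 (C.abs_θ hk)
  linarith

theorem abs_θ_sub_lt {j k : ℕ} (hj : j ≤ C.m) (hk : k ≤ C.m) : |C.θ j - C.θ k| < π :=
  abs_lt.2 ⟨by linarith [C.θ_sub_lt hk hj], C.θ_sub_lt hj hk⟩

theorem R_mul_cos {k : ℕ} (hk : k ≤ C.m) (s : ℝ) : C.R k * cos (C.θ k - s) = C.σ k s := by
  rw [C.σ_eq_polar hk, ← cos_neg, neg_sub]

theorem R_mul_sin {k : ℕ} (hk : k ≤ C.m) (s : ℝ) :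
    C.R k * sin (C.θ k - s) = C.σ k (s + π / 2) := by
  rw [C.σ_eq_polar hk, ← cos_pi_div_two_sub]
  congr 2; ring

theorem R_mul_sin_t {k : ℕ} (hk : k ≤ C.m) : C.R k * sin (C.θ k - C.t k) = C.fwd k := by
  rw [C.R_mul_sin hk, SupportChain.σ]
  simp

theorem R_mul_sin_t_succ {k : ℕ} (hk : k ≤ C.m) :
    C.R k * sin (C.θ k - C.t (k + 1)) = -C.bwd k := by
  rw [C.R_mul_sin hk, SupportChain.σ_eq]
  simp

theorem R_m : C.R C.m = C.R 0 := by
  have h : ∀ s, C.R C.m * cos (s - C.θ C.m) = C.R 0 * cos (s - C.t C.m - C.θ 0) := fun s => by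
    rw [← C.σ_eq_polar le_rfl, C.σ_m, C.σ_eq_polar (Nat.zero_le _)]
  have h1 := h (C.θ C.m)
  have h2 := h (C.t C.m + C.θ 0)
  rw [sub_self, cos_zero, mul_one] at h1
  rw [add_sub_cancel_left, sub_self, cos_zero, mul_one] at h2
  have r0 := C.R_pos (Nat.zero_le C.m)
  have rm := C.R_pos le_rfl
  have := mul_le_mul_of_nonneg_left (cos_le_one (C.θ C.m - C.t C.m - C.θ 0)) r0.le
  have := mul_le_mul_of_nonneg_left (cos_le_one (C.t C.m + C.θ 0 - C.θ C.m)) rm.le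
  linarith

/-- The rotation by the total angle determines `θ m` modulo `2π`, and the common half circle selects
the branch. The inner part thus overshoots the outer one by the curvature. -/
theorem θ_m : C.θ C.m = C.θ 0 - (2 * π - C.t C.m) := by
  have h1 : C.R C.m * cos (C.θ C.m - C.θ C.m) = C.R 0 * cos (C.θ C.m - C.t C.m - C.θ 0) := by
    rw [← C.σ_eq_polar le_rfl, C.σ_m, C.σ_eq_polar (Nat.zero_le _)]
  rw [R_m, sub_self, cos_zero] at h1
  have h2 := mul_left_cancel₀ (C.R_pos (Nat.zero_le C.m)).ne' h1
  obtain ⟨n, hn⟩ := (cos_eq_one_iff _).1 h2.symm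
  have h3 := C.θ_sub_lt le_rfl (Nat.zero_le C.m)
  have h4 := C.θ_sub_lt (Nat.zero_le C.m) le_rfl
  have h5 := C.t_m_lt
  have h6 : π ≤ C.t C.m := C.pi_le_t.trans (C.t_le C.N_lt)
  have n1 : n < 0 := by
    by_contra! hn0
    have : (0 : ℝ) ≤ n := by exact_mod_cast hn0
    nlinarith [pi_pos]
  have n2 : -2 < n := by
    by_contra! hn0
    have : (n : ℝ) ≤ -2 := by exact_mod_cast hn0
    nlinarith [pi_pos]
  obtain rfl : n = -1 := by lia
  push_cast at hn
  linarith

/-- Both sides are twice the signed area of the triangle spanned by the center and the edge. So the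
sign of `H` decides whether the polar angle advances or recedes. -/
theorem H_mul_len {k : ℕ} (hk : k < C.m) :
    C.H (k + 1) * C.len k = C.R (k + 1) * C.R k * sin (C.θ (k + 1) - C.θ k) := by
  have h1 := C.R_mul_cos (show k + 1 ≤ C.m from hk) (C.t (k + 1))
  have h2 := C.R_mul_cos hk.le (C.t (k + 1))
  have h3 := C.R_mul_sin_t (show k + 1 ≤ C.m from hk)
  have h4 := C.R_mul_sin_t_succ hk.le
  rw [C.σ_self] at h1
  rw [C.σ_succ_self] at h2
  rw [show C.θ (k + 1) - C.θ k = C.θ (k + 1) - C.t (k + 1) - (C.θ k - C.t (k + 1)) by ring,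
    sin_sub, SupportChain.len]
  linear_combination (-C.R (k + 1) * sin (C.θ (k + 1) - C.t (k + 1))) * h2 - C.H (k + 1) * h3
    + C.R (k + 1) * cos (C.θ (k + 1) - C.t (k + 1)) * h4 - C.bwd k * h1

theorem θ_le_succ {k : ℕ} (hk : k < C.N) : C.θ k ≤ C.θ (k + 1) := by
  have hN := C.N_lt
  by_contra! h
  have h1 := C.H_mul_len (show k < C.m by lia)
  have h2 := mul_nonneg (C.H_pos (k + 1) (by lia) (by lia)).le (C.len_nonneg' k)
  have h3 : sin (C.θ (k + 1) - C.θ k) < 0 := sin_neg_of_neg_of_neg_pi_lt (by linarith)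
    (by linarith [C.θ_sub_lt (show k ≤ C.m by lia) (show k + 1 ≤ C.m by lia)])
  have h4 := mul_pos (C.R_pos (show k + 1 ≤ C.m by lia)) (C.R_pos (show k ≤ C.m by lia))
  nlinarith

theorem θ_succ_le {k : ℕ} (hk : C.N ≤ k) (hk' : k < C.m) :
    C.θ (k + 1) ≤ C.θ k := by
  by_contra! h
  have h1 := C.H_mul_len hk'
  have h2 := mul_nonpos_of_nonpos_of_nonneg (C.H_nonpos (show C.N < k + 1 by lia) hk')
    (C.len_nonneg' k)
  have h3 : 0 < sin (C.θ (k + 1) - C.θ k) := sin_pos_of_pos_of_lt_pi (by linarith)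
    (C.θ_sub_lt hk' hk'.le)
  have h4 := mul_pos (C.R_pos (show k + 1 ≤ C.m from hk')) (C.R_pos hk'.le)
  nlinarith [mul_pos h4 h3]

theorem θ_succ_eq {k : ℕ} (hk' : k < C.m) (hH : C.H (k + 1) = 0) : C.θ (k + 1) = C.θ k := by
  have h1 := C.H_mul_len hk'
  rw [hH, zero_mul] at h1
  have h4 := mul_pos (C.R_pos (show k + 1 ≤ C.m from hk')) (C.R_pos hk'.le)
  have h5 := (mul_eq_zero.1 h1.symm).resolve_left h4.ne'
  have h6 := (sin_eq_zero_iff_of_lt_of_lt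
    (by linarith [C.θ_sub_lt hk'.le (show k + 1 ≤ C.m from hk')])
    (C.θ_sub_lt (show k + 1 ≤ C.m from hk') hk'.le)).1 h5
  linarith

end MixedChain

/-! ### The outer and the inner boundary curve. -/

namespace MixedChain

variable (C : MixedChain)

/-- The inverse distance from the center of the line through the `j`-th edge, as a function of the
direction. -/
noncomputable def line (j : ℕ) (s : ℝ) : ℝ := cos (s - C.t j) / C.H j

theorem isSinusoid_line (j : ℕ) : IsSinusoid (C.line j) := IsSinusoid.cos_sub_div _ _

theorem line_eq {k j : ℕ} (hk : k ≤ C.m) (hj : C.H j ≠ 0) (h : C.σ k (C.t j) = C.H j) :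
    C.line j (C.θ k) = 1 / C.R k := by
  rw [← C.R_mul_cos hk] at h
  rw [line, div_eq_div_iff hj (C.R_pos hk).ne']
  linarith

theorem line_le {k j : ℕ} (hk : k ≤ C.N) (hj : 0 < j) (hj' : j ≤ C.N) :
    C.line j (C.θ k) ≤ 1 / C.R k := by
  have hN := C.N_lt
  have h := C.σ_le_of_pos_block hk hj hj'
  rw [← C.R_mul_cos (by lia)] at h
  rw [line, div_le_div_iff₀ (C.H_pos j hj hj') (C.R_pos (by lia))]
  linarith

theorem le_line {k j : ℕ} (hk : C.N ≤ k) (hk' : k ≤ C.m) (hj : C.N < j) (hj' : j ≤ C.m)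
    (hH : C.H j < 0) : 1 / C.R k ≤ C.line j (C.θ k) := by
  have h := C.σ_le_of_nonpos_block hk hk' hj hj'
  rw [← C.R_mul_cos hk'] at h
  have hR := C.R_pos hk'
  rw [line, le_div_iff_of_neg hH, one_div, inv_mul_eq_div, le_div_iff₀ hR]
  linarith

noncomputable def posIndex : Finset ℕ := Finset.Ioc 0 C.N

-- An edge with `H = 0` is on a line through the center: it has no inverse radius and contributes no
-- area, so it is left out.
open Classical in
noncomputable def negIndex : Finset ℕ := {j ∈ Finset.Ioc C.N C.m | C.H j < 0}

theorem mem_posIndex {j : ℕ} : j ∈ C.posIndex ↔ 0 < j ∧ j ≤ C.N := Finset.mem_Ioc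

theorem mem_negIndex {j : ℕ} : j ∈ C.negIndex ↔ (C.N < j ∧ j ≤ C.m) ∧ C.H j < 0 := by
  simp [negIndex]

theorem posIndex_nonempty : C.posIndex.Nonempty := ⟨C.N, C.mem_posIndex.2 ⟨C.N_pos, le_rfl⟩⟩

theorem negIndex_nonempty : C.negIndex.Nonempty :=
  ⟨C.q, C.mem_negIndex.2 ⟨⟨C.q_gt, C.q_le⟩, C.H_q⟩⟩

/-- The inverse distance to the outer part of the polygon. -/
noncomputable def posCurve (s : ℝ) : ℝ := C.posIndex.sup' C.posIndex_nonempty fun j => C.line j s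

/-- The inverse distance to the inner part of the polygon. -/
noncomputable def negCurve (s : ℝ) : ℝ := C.negIndex.inf' C.negIndex_nonempty fun j => C.line j s

theorem continuous_posCurve : Continuous C.posCurve :=
  Continuous.finset_sup'_apply _ fun j _ => (C.isSinusoid_line j).continuous

theorem continuous_negCurve : Continuous C.negCurve :=
  Continuous.finset_inf'_apply _ fun j _ => (C.isSinusoid_line j).continuous

/-- At both ends of the sector the line of its own edge takes the value `1 / R`, which bounds the
other lines of the block. A sinusoidal difference that is nonnegative at the ends of an arc shorter
than `π` is so inside. -/
theorem posCurve_eq {k : ℕ} (hk : k < C.N) {s : ℝ} (h1 : C.θ k ≤ s) (h2 : s ≤ C.θ (k + 1)) :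
    C.posCurve s = C.line (k + 1) s := by
  have hN := C.N_lt
  have hH := (C.H_pos (k + 1) (by lia) (by lia)).ne'
  refine le_antisymm (Finset.sup'_le _ _ fun j hj => ?_)
    (Finset.le_sup' (fun j => C.line j s) (C.mem_posIndex.2 ⟨by lia, by lia⟩))
  rw [mem_posIndex] at hj
  have h := ((C.isSinusoid_line (k + 1)).sub (C.isSinusoid_line j)).nonneg_of_ends h1 h2
    (C.θ_sub_lt (by lia) (by lia))
    (by rw [C.line_eq (by lia) hH (C.σ_succ_self k)]; linarith [C.line_le hk.le hj.1 hj.2])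
    (by rw [C.line_eq (by lia) hH (C.σ_self (k + 1))]
        linarith [C.line_le (show k + 1 ≤ C.N by lia) hj.1 hj.2])
  linarith

theorem negCurve_eq {k : ℕ} (hk : C.N ≤ k) (hk' : k < C.m) (hH : C.H (k + 1) ≠ 0) {s : ℝ}
    (h1 : C.θ (k + 1) ≤ s) (h2 : s ≤ C.θ k) : C.negCurve s = C.line (k + 1) s := by
  have hneg := lt_of_le_of_ne (C.H_nonpos (show C.N < k + 1 by lia) hk') hH
  refine le_antisymm
    (Finset.inf'_le (fun j => C.line j s) (C.mem_negIndex.2 ⟨⟨by lia, hk'⟩, hneg⟩))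
    (Finset.le_inf' _ _ fun j hj => ?_)
  obtain ⟨⟨j1, j2⟩, j3⟩ := C.mem_negIndex.1 hj
  have h := ((C.isSinusoid_line j).sub (C.isSinusoid_line (k + 1))).nonneg_of_ends h1 h2
    (C.θ_sub_lt (by lia) (by lia))
    (by rw [C.line_eq hk' hH (C.σ_self (k + 1))]
        linarith [C.le_line (show C.N ≤ k + 1 by lia) hk' j1 j2 j3])
    (by rw [C.line_eq hk'.le hH (C.σ_succ_self k)]; linarith [C.le_line hk hk'.le j1 j2 j3])
  linarith

theorem θ_zero_le {k : ℕ} (hk : k ≤ C.N) : C.θ 0 ≤ C.θ k := by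
  induction k with
  | zero => exact le_rfl
  | succ k ih => exact (ih (by lia)).trans (C.θ_le_succ (by lia))

theorem θ_le_N {k : ℕ} (hk : k ≤ C.N) : C.θ k ≤ C.θ C.N := by
  induction hk using Nat.decreasingInduction with
  | self => exact le_rfl
  | of_succ k hk ih => exact (C.θ_le_succ hk).trans ih

theorem θ_le_N_of_ge {k : ℕ} (hk : C.N ≤ k) (hk' : k ≤ C.m) : C.θ k ≤ C.θ C.N := by
  induction k, hk using Nat.le_induction with
  | base => exact le_rfl
  | succ k hk ih => exact (C.θ_succ_le hk (by lia)).trans (ih (by lia))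

theorem θ_m_le {k : ℕ} (hk : C.N ≤ k) (hk' : k ≤ C.m) : C.θ C.m ≤ C.θ k := by
  induction hk' using Nat.decreasingInduction with
  | self => exact le_rfl
  | of_succ k hk' ih => exact (ih (by lia)).trans (C.θ_succ_le hk hk')

theorem exists_sector {s : ℝ} (h1 : C.θ 0 ≤ s) (h2 : s ≤ C.θ C.N) :
    ∃ k < C.N, C.θ k ≤ s ∧ s ≤ C.θ (k + 1) := by
  classical
  have hex : ∃ k, 0 < k ∧ s ≤ C.θ k := ⟨C.N, C.N_pos, h2⟩
  obtain ⟨hk0, hk⟩ := Nat.find_spec hex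
  have hkN : Nat.find hex ≤ C.N := Nat.find_min' hex ⟨C.N_pos, h2⟩
  obtain ⟨k, hk'⟩ : ∃ k, Nat.find hex = k + 1 := ⟨_, (Nat.succ_pred_eq_of_pos hk0).symm⟩
  rw [hk'] at hk hkN
  refine ⟨k, by lia, ?_, hk⟩
  rcases Nat.eq_zero_or_pos k with rfl | hpos
  · exact h1
  · by_contra! hlt
    exact Nat.find_min hex (m := k) (by lia) ⟨hpos, hlt.le⟩

theorem posCurve_pos {s : ℝ} (h1 : C.θ 0 ≤ s) (h2 : s ≤ C.θ C.N) : 0 < C.posCurve s := by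
  have hN := C.N_lt
  obtain ⟨k, hk, h3, h4⟩ := C.exists_sector h1 h2
  have hH := (C.H_pos (k + 1) (by lia) (by lia)).ne'
  rw [C.posCurve_eq hk h3 h4]
  have r1 := C.R_pos (show k ≤ C.m by lia)
  have r2 := C.R_pos (show k + 1 ≤ C.m by lia)
  refine (C.isSinusoid_line (k + 1)).pos_of_ends h3 h4 (C.θ_sub_lt (by lia) (by lia)) ?_ ?_
  · rw [C.line_eq (by lia) hH (C.σ_succ_self k)]; positivity
  · rw [C.line_eq (by lia) hH (C.σ_self (k + 1))]; positivity

theorem negCurve_pos {s : ℝ} (h1 : C.θ C.m ≤ s) (h2 : s ≤ C.θ C.N) : 0 < C.negCurve s := by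
  refine (Finset.lt_inf'_iff _).2 fun j hj => ?_
  obtain ⟨⟨j1, j2⟩, j3⟩ := C.mem_negIndex.1 hj
  have rm := C.R_pos le_rfl
  have rN := C.R_pos C.N_lt.le
  refine (C.isSinusoid_line j).pos_of_ends h1 h2 (C.θ_sub_lt C.N_lt.le le_rfl) ?_ ?_
  · exact (one_div_pos.2 rm).trans_le (C.le_line C.N_lt.le le_rfl j1 j2 j3)
  · exact (one_div_pos.2 rN).trans_le (C.le_line le_rfl C.N_lt.le j1 j2 j3)

/-- At the ends of their ranges the curves are separated by the inverse radii of the vertices they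
share: `1 / R N` on the right, and `1 / R 0 = 1 / R m` on the left, up to the rotation. -/
theorem dominatedBelow_curves :
    DominatedBelow C.posCurve C.negCurve (C.θ 0) (C.θ C.N) (2 * π - C.t C.m) := by
  have hm := C.θ_m
  have hlt := C.θ_sub_lt C.N_lt.le (le_refl C.m)
  have hN := C.N_lt
  refine dominatedBelow (C.θ_zero_le le_rfl) (by linarith [C.t_m_lt]) (by rw [← hm]; exact hlt)
    C.continuous_posCurve.continuousOn C.continuous_negCurve.continuousOn
    (fun s hs => C.posCurve_pos hs.1 hs.2) (fun s hs => C.negCurve_pos (hm ▸ hs.1) hs.2)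
    (sinConvexOn_sup' _ C.isSinusoid_line (C.θ_sub_lt hN.le (Nat.zero_le _)))
    (sinConcaveOn_inf' _ C.isSinusoid_line (by rw [← hm]; exact hlt)) ?_ ?_
  · rw [← hm]
    refine Finset.sup'_le _ _ fun j hj => Finset.le_inf' _ _ fun i hi => ?_
    obtain ⟨⟨i1, i2⟩, i3⟩ := C.mem_negIndex.1 hi
    rw [mem_posIndex] at hj
    have h := C.le_line hN.le le_rfl i1 i2 i3
    rw [C.R_m] at h
    exact (C.line_le (Nat.zero_le _) hj.1 hj.2).trans h
  · refine Finset.sup'_le _ _ fun j hj => Finset.le_inf' _ _ fun i hi => ?_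
    obtain ⟨⟨i1, i2⟩, i3⟩ := C.mem_negIndex.1 hi
    rw [mem_posIndex] at hj
    exact (C.line_le le_rfl hj.1 hj.2).trans (C.le_line le_rfl hN.le i1 i2 i3)

/-- The weighted area over the `k + 1`-st edge. -/
noncomputable def edgeWeight (l : ℝ) (k : ℕ) : ℝ :=
  legWeight l (C.H (k + 1)) (C.fwd (k + 1)) + legWeight l (C.H (k + 1)) (C.bwd k)

theorem integral_line (l : ℝ) {k : ℕ} (hk : k < C.m) (hH : C.H (k + 1) ≠ 0) :
    ∫ s in C.θ k..C.θ (k + 1), sectorWeight l (C.line (k + 1) s) = C.edgeWeight l k :=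
  integral_sectorWeight_edge l hH (C.R_pos hk) (C.R_pos hk.le) (C.abs_θ_sub_lt hk hk.le)
    ((C.R_mul_cos hk _).trans (C.σ_self _)) (C.R_mul_sin_t hk)
    ((C.R_mul_cos hk.le _).trans (C.σ_succ_self k)) (C.R_mul_sin_t_succ hk.le)

theorem sum_edgeWeight_pos (l : ℝ) : ∑ k ∈ Finset.range C.N, C.edgeWeight l k =
    ∫ s in C.θ 0..C.θ C.N, sectorWeight l (C.posCurve s) := by
  have hN := C.N_lt
  rw [← intervalIntegral.sum_integral_adjacent_intervals fun k hk =>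
    intervalIntegrable_comp_of_pos (continuousOn_sectorWeight l)
      C.continuous_posCurve.continuousOn (fun s hs => C.posCurve_pos hs.1 hs.2)
      (C.θ_zero_le hk.le) (C.θ_le_succ hk) (C.θ_le_N hk)]
  refine Finset.sum_congr rfl fun k hk => ?_
  rw [Finset.mem_range] at hk
  rw [← C.integral_line l (by lia) (C.H_pos (k + 1) (by lia) (by lia)).ne']
  refine intervalIntegral.integral_congr fun s hs => ?_
  rw [Set.uIcc_of_le (C.θ_le_succ hk)] at hs
  simp only [C.posCurve_eq hk hs.1 hs.2]

theorem sum_edgeWeight_neg (l : ℝ) : ∑ k ∈ Finset.Ico C.N C.m, C.edgeWeight l k =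
    -∫ s in C.θ C.m..C.θ C.N, sectorWeight l (C.negCurve s) := by
  rw [← intervalIntegral.integral_symm,
    ← intervalIntegral.sum_integral_adjacent_intervals_Ico C.N_lt.le fun k hk =>
    (intervalIntegrable_comp_of_pos (continuousOn_sectorWeight l)
      C.continuous_negCurve.continuousOn (fun s hs => C.negCurve_pos hs.1 hs.2)
      (C.θ_m_le (k := k + 1) (by have := hk.1; lia) hk.2) (C.θ_succ_le hk.1 hk.2)
      (C.θ_le_N_of_ge hk.1 hk.2.le)).symm]
  refine Finset.sum_congr rfl fun k hk => ?_
  rw [Finset.mem_Ico] at hk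
  by_cases hH : C.H (k + 1) = 0
  · rw [C.θ_succ_eq hk.2 hH, intervalIntegral.integral_same, edgeWeight, hH]
    simp [legWeight, legArea_zero_left]
  rw [← C.integral_line l hk.2 hH]
  refine intervalIntegral.integral_congr fun s hs => ?_
  rw [Set.uIcc_of_ge (C.θ_succ_le hk.1 hk.2)] at hs
  simp only [C.negCurve_eq hk.1 hk.2 hH hs.1 hs.2]

theorem area_pos (h : 0 < C.excess) :
    0 < ∑ k ∈ Finset.range C.m, C.H (k + 1) * C.len k := by
  obtain ⟨c, hc, hdom⟩ := C.dominatedBelow_curves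
  obtain ⟨f1, f2, f3⟩ := sectorWeight_unimodal hc
  set l := (c / √(1 + c ^ 2)) ^ 3 with hl
  have hl0 : 0 < l := by positivity
  have h1 := hdom _ (continuousOn_sectorWeight l) f1 f2 f3
  rw [← C.θ_m, ← C.sum_edgeWeight_pos] at h1
  have h2 := Finset.sum_range_add_sum_Ico (C.edgeWeight l) C.N_lt.le
  rw [C.sum_edgeWeight_neg] at h2
  -- The sum of `H * len` is twice the Euclidean area, whence `l / 2`.
  have h3 : ∑ k ∈ Finset.range C.m, C.edgeWeight l k
      = C.excess - l / 2 * ∑ k ∈ Finset.range C.m, C.H (k + 1) * C.len k := by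
    rw [C.excess_eq, Finset.mul_sum, ← Finset.sum_sub_distrib]
    refine Finset.sum_congr rfl fun k _ => ?_
    rw [edgeWeight, legWeight, legWeight, SupportChain.len]
    ring
  have h4 : 0 < l / 2 * ∑ k ∈ Finset.range C.m, C.H (k + 1) * C.len k := by linarith
  exact pos_of_mul_pos_right h4 (by positivity)

end MixedChain

/-! ### Positivity of the area by the signs of the support numbers. -/

namespace SupportChain

variable (C : SupportChain)

/-- If the area vanished, each edge would have support number or length zero; in either case its
spherical area vanishes too, against the positive excess. -/
theorem area_pos_of_nonneg (hH : ∀ k < C.m, 0 ≤ C.H (k + 1)) (h : 0 < C.excess) :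
    0 < ∑ k ∈ Finset.range C.m, C.H (k + 1) * C.len k := by
  have hnn : ∀ k ∈ Finset.range C.m, 0 ≤ C.H (k + 1) * C.len k := fun k hk =>
    mul_nonneg (hH k (Finset.mem_range.1 hk)) (C.len_nonneg' k)
  refine lt_of_le_of_ne (Finset.sum_nonneg hnn) fun h0 => h.ne' ?_
  rw [excess_eq]
  refine Finset.sum_eq_zero fun k hk => ?_
  rcases mul_eq_zero.1 ((Finset.sum_eq_zero_iff_of_nonneg hnn).1 h0.symm k hk) with h1 | h1
  · rw [h1, legArea_zero_left, legArea_zero_left, add_zero]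
  · rw [len, add_eq_zero_iff_eq_neg] at h1
    rw [h1, legArea_neg, neg_add_cancel]

theorem excess_nonpos_of_nonpos (hH : ∀ k < C.m, C.H (k + 1) ≤ 0) : C.excess ≤ 0 := by
  rw [excess_eq]
  exact Finset.sum_nonpos fun k hk =>
    legArea_add_nonpos (hH k (Finset.mem_range.1 hk)) (C.len_nonneg' k)

theorem area_pos_of_sign_change (h0 : C.H 0 ≤ 0) (h1 : 0 < C.H 1) (h : 0 < C.excess) :
    0 < ∑ k ∈ Finset.range C.m, C.H (k + 1) * C.len k := by
  classical
  have hm : 1 < C.m := by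
    rcases Nat.lt_or_ge 1 C.m with hm | hm
    · exact hm
    · have hm0 : C.m ≠ 0 := fun hm0 => by simp [excess, hm0] at h
      have := C.H_m
      rw [show C.m = 1 by lia] at this
      linarith
  have hex : ∃ k, 0 < k ∧ C.H (k + 1) ≤ 0 :=
    ⟨C.m - 1, by lia, by rw [show C.m - 1 + 1 = C.m by lia, C.H_m]; exact h0⟩
  obtain ⟨hN0, hN⟩ := Nat.find_spec hex
  have hNm : Nat.find hex ≤ C.m - 1 :=
    Nat.find_min' hex ⟨by lia, by rw [show C.m - 1 + 1 = C.m by lia, C.H_m]; exact h0⟩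
  have hpos : ∀ i, 0 < i → i ≤ Nat.find hex → 0 < C.H i := by
    intro i hi hi'
    rcases Nat.lt_or_ge 1 i with h2 | h2
    · have := Nat.find_min hex (m := i - 1) (by lia)
      rw [show i - 1 + 1 = i by lia] at this
      by_contra! h3
      exact this ⟨by lia, h3⟩
    · rwa [show i = 1 by lia]
  -- If nothing after the first positive block is strictly negative, all support numbers are
  -- nonnegative and the simpler case applies.
  by_cases hq : ∃ q, Nat.find hex < q ∧ q ≤ C.m ∧ C.H q < 0
  · obtain ⟨q, q1, q2, q3⟩ := hq
    exact MixedChain.area_pos ⟨C, Nat.find hex, q, h0, hN0, hpos, hN, by lia, q1, q2, q3⟩ h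
  · push Not at hq
    refine C.area_pos_of_nonneg (fun k hk => ?_) h
    rcases Nat.lt_or_ge (Nat.find hex) (k + 1) with h2 | h2
    · exact hq _ h2 hk
    · exact (hpos _ k.succ_pos h2).le

end SupportChain

/-! ### Trigonometry of a pyramid. -/

/-- The component of `v` orthogonal to `u`. -/
noncomputable def perp (u v : E3) : E3 := v - (inner ℝ u v / inner ℝ u u) • u

theorem dihedralAngle_eq (u v w : E3) :
    dihedralAngle u v w = InnerProductGeometry.angle (perp u v) (perp u w) := rfl

theorem perp_smul {a b : ℝ} (ha : a ≠ 0) (u v : E3) : perp (a • u) (b • v) = b • perp u v := by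
  rcases eq_or_ne u 0 with rfl | hu
  · simp [perp]
  have : inner ℝ u u ≠ 0 := inner_self_ne_zero.2 hu
  simp only [perp, inner_smul_left, inner_smul_right, smul_sub, smul_smul, RCLike.conj_to_real]
  congr 2
  field_simp

theorem perp_add_smul {u : E3} (hu : u ≠ 0) (v : E3) (s : ℝ) : perp u (v + s • u) = perp u v := by
  have : inner ℝ u u ≠ 0 := inner_self_ne_zero.2 hu
  simp only [perp, inner_add_right, inner_smul_right, add_div, mul_div_cancel_right₀ _ this,
    add_smul]
  abel

theorem dihedralAngle_smul {a b c : ℝ} (ha : a ≠ 0) (hb : 0 < b) (hc : 0 < c) (u v w : E3) :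
    dihedralAngle (a • u) (b • v) (c • w) = dihedralAngle u v w := by
  rw [dihedralAngle_eq, perp_smul ha, perp_smul ha,
    InnerProductGeometry.angle_smul_left_of_pos _ _ hb,
    InnerProductGeometry.angle_smul_right_of_pos _ _ hc, ← dihedralAngle_eq]

theorem dihedralAngle_comm (u v w : E3) : dihedralAngle u v w = dihedralAngle u w v :=
  InnerProductGeometry.angle_comm _ _

/-- The dihedral angle at an edge can be computed from either end of the edge. -/
theorem dihedralAngle_edge_comm {p q : E3} (hpq : p ≠ q) (a b : E3) :
    dihedralAngle (p - q) (a - q) (b - q) = dihedralAngle (q - p) (a - p) (b - p) := by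
  have h : q - p ≠ 0 := sub_ne_zero.2 hpq.symm
  have h1 : p - q = (-1 : ℝ) • (q - p) := by simp
  have h2 : ∀ a : E3, a - q = (1 : ℝ) • (a - p + (-1 : ℝ) • (q - p)) := fun a => by
    rw [one_smul, neg_one_smul]; abel
  rw [h1, h2 a, h2 b, dihedralAngle_smul (by norm_num) one_pos one_pos, dihedralAngle_eq,
    perp_add_smul h, perp_add_smul h, ← dihedralAngle_eq]

theorem inner_perp_perp {u : E3} (hu : u ≠ 0) (v w : E3) :
    inner ℝ (perp u v) (perp u w) = inner ℝ v w - inner ℝ u v * inner ℝ u w / inner ℝ u u := by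
  have : inner ℝ u u ≠ 0 := inner_self_ne_zero.2 hu
  simp only [perp, inner_sub_left, inner_sub_right, inner_smul_left, inner_smul_right,
    RCLike.conj_to_real, real_inner_comm u v]
  field_simp
  ring

theorem sq_norm_perp {u : E3} (hu : u ≠ 0) (v : E3) :
    ‖perp u v‖ ^ 2 = ‖v‖ ^ 2 - inner ℝ u v ^ 2 / ‖u‖ ^ 2 := by
  rw [← real_inner_self_eq_norm_sq, inner_perp_perp hu, real_inner_self_eq_norm_sq,
    real_inner_self_eq_norm_sq, sq (inner ℝ u v)]

theorem norm_mul_sin_angle {u : E3} (hu : u ≠ 0) (v : E3) :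
    ‖v‖ * sin (InnerProductGeometry.angle u v) = ‖perp u v‖ := by
  refine (sq_eq_sq₀ (mul_nonneg (norm_nonneg _) (InnerProductGeometry.sin_angle_nonneg _ _))
    (norm_nonneg _)).1 ?_
  have h := InnerProductGeometry.cos_angle_mul_norm_mul_norm u v
  have hu' : ‖u‖ ≠ 0 := norm_ne_zero_iff.2 hu
  rw [sq_norm_perp hu, mul_pow, sin_sq, ← h]
  field_simp

/-- The cotangent of the angle at `u` in the triangle `0 u v`. -/
noncomputable def cotAt (u v : E3) : ℝ := (‖u‖ ^ 2 - inner ℝ u v) / (‖u‖ * ‖perp u v‖)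

theorem cotAt_eq {u v : E3} (hu : u ≠ 0) (hv : v ≠ 0) (hp : perp u v ≠ 0) :
    ‖u‖ * ((1 / ‖v‖ - 1 / ‖u‖ * cos (InnerProductGeometry.angle u v))
      / sin (InnerProductGeometry.angle u v)) = cotAt u v := by
  have h1 : ‖u‖ ≠ 0 := norm_ne_zero_iff.2 hu
  have h2 : ‖v‖ ≠ 0 := norm_ne_zero_iff.2 hv
  have h3 : ‖perp u v‖ ≠ 0 := norm_ne_zero_iff.2 hp
  have h4 : sin (InnerProductGeometry.angle u v) = ‖perp u v‖ / ‖v‖ := by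
    rw [← norm_mul_sin_angle hu]; field_simp
  rw [h4, InnerProductGeometry.cos_angle, cotAt]
  field_simp

theorem perp_ne_zero {u v w : E3} (h : LinearIndependent ℝ ![u, v, w]) : perp u v ≠ 0 := by
  intro h0
  have := Fintype.linearIndependent_iff.1 h ![-(inner ℝ u v / inner ℝ u u), 1, 0] (by
    rw [perp, sub_eq_zero] at h0
    simp only [Fin.sum_univ_three, Matrix.cons_val_zero, Matrix.cons_val_one, Matrix.cons_val,
      neg_smul, one_smul, zero_smul, add_zero]
    rw [neg_add_eq_zero]
    exact h0.symm) 1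
  simp at this

theorem linearIndependent_swap {u v w : E3} (h : LinearIndependent ℝ ![u, v, w]) :
    LinearIndependent ℝ ![u, w, v] := by
  have := h.comp ![0, 2, 1] (by decide)
  convert this using 1
  ext i : 1
  fin_cases i <;> rfl

theorem dihedralAngle_mem {u v w : E3} (h : LinearIndependent ℝ ![u, v, w]) :
    dihedralAngle u v w ∈ Set.Ioo 0 π := by
  have key : ∀ c : ℝ, perp u w ≠ c • perp u v := by
    intro c hc
    have h0 : (c * (inner ℝ u v / inner ℝ u u) - inner ℝ u w / inner ℝ u u) • u
        + (-c) • v + (1 : ℝ) • w = 0 := by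
      unfold perp at hc
      rw [← sub_eq_zero] at hc
      rw [← hc]
      module
    have := Fintype.linearIndependent_iff.1 h
      ![c * (inner ℝ u v / inner ℝ u u) - inner ℝ u w / inner ℝ u u, -c, 1] (by
        simpa [Fin.sum_univ_three] using h0) 2
    simp at this
  rw [dihedralAngle_eq]
  refine ⟨lt_of_le_of_ne (InnerProductGeometry.angle_nonneg _ _) fun h => ?_,
    lt_of_le_of_ne (InnerProductGeometry.angle_le_pi _ _) fun h => ?_⟩
  · obtain ⟨-, c, -, hc⟩ := InnerProductGeometry.angle_eq_zero_iff.1 h.symm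
    exact key c hc
  · obtain ⟨-, c, -, hc⟩ := InnerProductGeometry.angle_eq_pi_iff.1 h
    exact key c hc

theorem ne_zero_of_indep {u v w : E3} (h : LinearIndependent ℝ ![u, v, w]) : u ≠ 0 := h.ne_zero 0

section Pyramid

variable {u v w : E3}

/-- The vectors `v - u` and `w - u` are split along `u` and orthogonally to it; the cotangent is the
ratio of the two parts. -/
theorem inner_base (h : LinearIndependent ℝ ![u, v, w]) : inner ℝ (v - u) (w - u)
    = ‖perp u v‖ * ‖perp u w‖ * (cos (dihedralAngle u v w) + cotAt u v * cotAt u w) := by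
  have hu := ne_zero_of_indep h
  have h1 : ‖u‖ ≠ 0 := norm_ne_zero_iff.2 hu
  have h2 : ‖perp u v‖ ≠ 0 := norm_ne_zero_iff.2 (perp_ne_zero h)
  have h3 : ‖perp u w‖ ≠ 0 := norm_ne_zero_iff.2 (perp_ne_zero (linearIndependent_swap h))
  have h4 := inner_perp_perp hu v w
  rw [← InnerProductGeometry.cos_angle_mul_norm_mul_norm, ← dihedralAngle_eq,
    real_inner_self_eq_norm_sq] at h4
  have h5 : ‖perp u v‖ * ‖perp u w‖ * (cotAt u v * cotAt u w)
      = (‖u‖ ^ 2 - inner ℝ u v) * (‖u‖ ^ 2 - inner ℝ u w) / ‖u‖ ^ 2 := by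
    rw [cotAt, cotAt]; field_simp
  rw [mul_add, h5, mul_comm (_ * _) (cos _), h4]
  simp only [inner_sub_left, inner_sub_right, real_inner_self_eq_norm_sq, real_inner_comm u v]
  field_simp
  ring

theorem sq_norm_base (h : LinearIndependent ℝ ![u, v, w]) : ‖v - u‖ ^ 2 = ‖perp u v‖ ^ 2 * (1 + cotAt u v ^ 2) := by
  have hu := ne_zero_of_indep h
  have h1 : ‖u‖ ≠ 0 := norm_ne_zero_iff.2 hu
  have h2 : ‖perp u v‖ ≠ 0 := norm_ne_zero_iff.2 (perp_ne_zero h)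
  have h5 : ‖perp u v‖ ^ 2 * cotAt u v ^ 2 = (‖u‖ ^ 2 - inner ℝ u v) ^ 2 / ‖u‖ ^ 2 := by
    rw [cotAt]; field_simp
  rw [mul_add, h5, mul_one, sq_norm_perp hu, norm_sub_sq_real, real_inner_comm]
  field_simp
  ring

/-- The law of cosines in the spherical triangle cut out at the vertex `u` of the pyramid. -/
theorem angle_base_eq (h : LinearIndependent ℝ ![u, v, w]) : InnerProductGeometry.angle (v - u) (w - u)
    = oppositeSide (cotAt u v) (cotAt u w) (dihedralAngle u v w) := by
  have h2 : 0 < ‖perp u v‖ := norm_pos_iff.2 (perp_ne_zero h)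
  have h3 : 0 < ‖perp u w‖ := norm_pos_iff.2 (perp_ne_zero (linearIndependent_swap h))
  have e1 : ‖v - u‖ = ‖perp u v‖ * √(1 + cotAt u v ^ 2) := by
    rw [← sqrt_sq (norm_nonneg (v - u)), sq_norm_base h, sqrt_mul (by positivity),
      sqrt_sq h2.le]
  have e2 : ‖w - u‖ = ‖perp u w‖ * √(1 + cotAt u w ^ 2) := by
    rw [← sqrt_sq (norm_nonneg (w - u)), sq_norm_base (linearIndependent_swap h),
      sqrt_mul (by positivity), sqrt_sq h3.le]
  rw [InnerProductGeometry.angle, inner_base h, e1, e2, oppositeSide, sqrt_mul (by positivity),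
    mul_mul_mul_comm, mul_div_mul_left _ _ (by positivity), add_comm]

/-- The dihedral angle at the base edge `u v` of the pyramid. -/
theorem dihedralAngle_base_eq (h : LinearIndependent ℝ ![u, v, w]) : dihedralAngle (v - u) (0 - u) (w - u)
    = arccos (((cotAt u w - cotAt u v * cos (dihedralAngle u v w)) / sin (dihedralAngle u v w)) /
      √(1 + cotAt u v ^ 2 + 1 * ((cotAt u w - cotAt u v * cos (dihedralAngle u v w))
        / sin (dihedralAngle u v w)) ^ 2)) := by
  have hu := ne_zero_of_indep h
  have h1 : 0 < ‖u‖ := norm_pos_iff.2 hu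
  have h2 : 0 < ‖perp u v‖ := norm_pos_iff.2 (perp_ne_zero h)
  have h3 : 0 < ‖perp u w‖ := norm_pos_iff.2 (perp_ne_zero (linearIndependent_swap h))
  have hω := dihedralAngle_mem h
  have hS : 0 < sin (dihedralAngle u v w) := sin_pos_of_pos_of_lt_pi hω.1 hω.2
  have hcs := sin_sq_add_cos_sq (dihedralAngle u v w)
  have i1 := inner_base h
  have i2 := sq_norm_base h
  have i3 := sq_norm_base (linearIndependent_swap h)
  have i4 : ∀ z, 0 < ‖perp u z‖ → inner ℝ (0 - u) (z - u) = ‖u‖ * ‖perp u z‖ * cotAt u z := by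
    intro z hz
    rw [cotAt, zero_sub, inner_neg_left, inner_sub_right, real_inner_self_eq_norm_sq]
    field_simp
    ring
  have hQ : 0 < 1 + cotAt u v ^ 2 := by positivity
  have he2 : 0 < ‖v - u‖ ^ 2 := by rw [i2]; positivity
  have he : v - u ≠ 0 := by
    intro h0; rw [h0] at he2; simp at he2
  have j1 := inner_perp_perp he (0 - u) (w - u)
  rw [real_inner_comm (0 - u) (v - u), i4 v h2, i4 w h3, i1, real_inner_self_eq_norm_sq, i2] at j1
  have j2 := sq_norm_perp he (0 - u)
  rw [real_inner_comm (0 - u) (v - u), i4 v h2, i2, zero_sub, norm_neg] at j2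
  have j3 := sq_norm_perp he (w - u)
  rw [i1, i2, i3] at j3
  set H := cotAt u v
  set H' := cotAt u w
  set c := cos (dihedralAngle u v w)
  set s := sin (dihedralAngle u v w)
  set a := ‖perp u v‖
  set b := ‖perp u w‖
  set r := ‖u‖
  set x := (H' - H * c) / s with hx
  have hX : 0 < 1 + H ^ 2 + 1 * x ^ 2 := by positivity
  have k2 : ‖perp (v - u) (-u)‖ = r / √(1 + H ^ 2) := by
    refine (sq_eq_sq₀ (norm_nonneg _) (by positivity)).1 ?_
    rw [j2, div_pow, sq_sqrt hQ.le]
    field_simp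
    ring
  have k3 : ‖perp (v - u) (w - u)‖ = b * s * √(1 + H ^ 2 + 1 * x ^ 2) / √(1 + H ^ 2) := by
    refine (sq_eq_sq₀ (norm_nonneg _) (by positivity)).1 ?_
    rw [j3, div_pow, mul_pow (b * s), sq_sqrt hQ.le, sq_sqrt hX.le, hx]
    field_simp
    linear_combination (-(1 + H ^ 2)) * hcs
  rw [dihedralAngle_eq, InnerProductGeometry.angle, j1, zero_sub, k2, k3]
  congr 1
  have hsq := sq_sqrt hQ.le
  have hw : 0 < √(1 + H ^ 2) := by positivity
  have hv : 0 < √(1 + H ^ 2 + 1 * x ^ 2) := by positivity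
  set w' := √(1 + H ^ 2)
  have l1 : r * b * H' - r * a * H * (a * b * (c + H * H')) / (a ^ 2 * (1 + H ^ 2))
      = r * b * (x * s) / w' ^ 2 := by
    rw [hsq, hx]
    field_simp
    ring
  rw [l1]
  field_simp

end Pyramid

/-! ### Dual quantities of the polytope in terms of its pyramids. -/

namespace GenPolytope

variable {V D : Type*} [Fintype V] [Fintype D] {M : PolyhedralSphere V D} (P : GenPolytope M)

/-- One rotation step around the starting vertex of a dart. -/
def rot (M : PolyhedralSphere V D) : Equiv.Perm D := M.opp * M.next * M.next

theorem rot_apply (d : D) : rot M d = M.opp (M.prev d) := rfl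

theorem org_rot (d : D) : M.org (rot M d) = M.org d := by
  rw [rot_apply, M.org_opp, M.next_prev]

theorem org_iterate_rot (d : D) (k : ℕ) : M.org (((rot M)^[k]) d) = M.org d := by
  induction k with
  | zero => rfl
  | succ k ih => rw [Function.iterate_succ_apply', org_rot, ih]

theorem opp_rot (d : D) : M.opp (rot M d) = M.prev d := M.opp_opp _

theorem next_opp_rot (d : D) : M.next (M.opp (rot M d)) = d := by
  rw [opp_rot, M.next_prev]

/-- The cotangent of the angle at the starting vertex of `d` in the triangle over `d`. -/
noncomputable def cot (d : D) : ℝ := P.r (M.org d) * P.dual.hEdge d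

theorem cot_eq (d : D) : P.cot d = cotAt (P.pos d) (P.pos (M.next d)) := by
  rw [← cotAt_eq (P.pos_ne_zero _) (P.pos_ne_zero _) (perp_ne_zero (P.pos_indep d)), P.norm_pos,
    P.norm_pos]
  rfl

/-- The dart `rot M d` runs along the other side of the triangle of `d` at the same vertex, so its
cotangent can be read off in the pyramid of `d`. -/
theorem cot_rot (d : D) : P.cot (rot M d) = cotAt (P.pos d) (P.pos (M.prev d)) := by
  have h : P.apexAngle (rot M d)
      = InnerProductGeometry.angle (P.pos d) (P.pos (M.prev d)) := by
    rw [rot_apply, P.apexAngle_opp, apexAngle, M.next_prev, InnerProductGeometry.angle_comm]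
  have h2 : M.org (M.next (rot M d)) = M.org (M.prev d) := by
    rw [rot_apply, M.org_next_opp]
  rw [← cotAt_eq (P.pos_ne_zero _) (P.pos_ne_zero _)
    (perp_ne_zero (linearIndependent_swap (P.pos_indep d))), P.norm_pos, P.norm_pos, ← h, ← h2]
  change P.r (M.org (rot M d)) * _ = _
  rw [org_rot]
  change _ * ((1 / P.r _ - 1 / P.r (M.org (rot M d)) * cos (P.apexAngle _)) / _) = _
  rw [org_rot]
  rfl

theorem ω_dual (d : D) : P.dual.ω d = P.radialAngle d :=
  have h : ∀ d, 0 < ‖P.pos d‖⁻¹ := fun d => inv_pos.2 (norm_pos_iff.2 (P.pos_ne_zero d))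
  dihedralAngle_smul (h d).ne' (h _) (h _) _ _ _

theorem radialAngle_mem (d : D) : P.radialAngle d ∈ Set.Ioo 0 π := dihedralAngle_mem (P.pos_indep d)

theorem cornerAngle_eq (d : D) :
    M.cornerAngle d = oppositeSide (P.cot d) (P.cot (rot M d)) (P.radialAngle d) := by
  rw [cot_eq, cot_rot, radialAngle, ← angle_base_eq (P.pos_indep d)]
  have h1 : ‖P.pos (M.next d) - P.pos d‖ = M.len d := by
    rw [← dist_eq_norm, dist_comm, P.dist_pos]
  have h2 : ‖P.pos (M.prev d) - P.pos d‖ = M.len (M.prev d) := by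
    rw [← P.dist_pos, M.next_prev, dist_eq_norm]
  have h3 : ‖P.pos (M.next d) - P.pos d - (P.pos (M.prev d) - P.pos d)‖ = M.len (M.next d) := by
    rw [sub_sub_sub_cancel_right, ← dist_eq_norm, ← P.dist_pos]
    rfl
  rw [InnerProductGeometry.angle,
    real_inner_eq_norm_mul_self_add_norm_mul_self_sub_norm_sub_mul_self_div_two, h1, h2, h3,
    PolyhedralSphere.cornerAngle]
  congr 1
  rw [div_div]
  congr 1 <;> ring

theorem r_mul_hLeft (d : D) : P.r (M.org d) * P.dual.hLeft d =
    (P.cot (rot M d) - P.cot d * cos (P.radialAngle d)) / sin (P.radialAngle d) := by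
  rw [GenPolyhedron.hLeft, ω_dual, cot, cot, org_rot, rot_apply]
  ring

theorem r_mul_hRight (d : D) : P.r (M.org (rot M d)) * P.dual.hRight (rot M d) =
    (P.cot d - P.cot (rot M d) * cos (P.radialAngle d)) / sin (P.radialAngle d) := by
  rw [GenPolyhedron.hRight, ω_dual, next_opp_rot, cot, cot, org_rot]
  ring

/-- The factor `1 *` keeps the shape `x / √(c + d x²)` of `div_sqrt_add_nonneg_iff`. -/
theorem baseAngle_eq (d : D) : P.baseAngle d = arccos (P.r (M.org d) * P.dual.hLeft d /
    √(1 + P.cot d ^ 2 + 1 * (P.r (M.org d) * P.dual.hLeft d) ^ 2)) := by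
  rw [baseAngle, dihedralAngle_base_eq (P.pos_indep d), r_mul_hLeft, cot_rot, cot_eq]
  rfl

theorem baseAngle_opp_rot (d : D) : P.baseAngle (M.opp (rot M d)) =
    arccos (P.r (M.org (rot M d)) * P.dual.hRight (rot M d) /
    √(1 + P.cot (rot M d) ^ 2 + 1 * (P.r (M.org (rot M d)) * P.dual.hRight (rot M d)) ^ 2)) := by
  have hli := P.pos_indep d
  have hne : P.pos d ≠ P.pos (M.prev d) := fun h => by
    have := (linearIndependent_swap hli).injective.ne (show (0 : Fin 3) ≠ 1 by decide)
    exact this h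
  have hpp : M.prev (M.prev d) = M.next d := by
    change M.next (M.next (M.prev d)) = _
    rw [M.next_prev]
  rw [baseAngle, opp_rot, M.next_prev, hpp, dihedralAngle_edge_comm hne,
    dihedralAngle_base_eq (linearIndependent_swap hli), r_mul_hRight, cot_eq, cot_rot,
    dihedralAngle_comm (P.pos d)]
  rfl

/-- The two base angles are arccosines of the same odd increasing function, taken at the two parts
of the dual edge. Their sum is at most `π` only if the two parts add up to something nonnegative. -/
theorem IsConvex.edgeLength_nonneg {P : GenPolytope M} (hP : P.IsConvex) (d : D) :
    0 ≤ P.r (M.org d) * P.dual.hLeft d + P.r (M.org d) * P.dual.hRight d := by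
  obtain ⟨e, rfl⟩ := (rot M).surjective d
  have h := hP (rot M e)
  rw [baseAngle_eq, baseAngle_opp_rot] at h
  have hQ : 0 < 1 + P.cot (rot M e) ^ 2 := by positivity
  refine (div_sqrt_add_nonneg_iff hQ zero_le_one _ _).1 ?_
  set x := P.r (M.org (rot M e)) * P.dual.hLeft (rot M e)
  set y := P.r (M.org (rot M e)) * P.dual.hRight (rot M e)
  have hb : ∀ x : ℝ, |x / √(1 + P.cot (rot M e) ^ 2 + 1 * x ^ 2)| ≤ 1 := by
    intro x
    have hX : 0 < √(1 + P.cot (rot M e) ^ 2 + 1 * x ^ 2) := by positivity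
    rw [abs_div, abs_of_pos hX, div_le_one hX]
    exact abs_le_sqrt (by nlinarith)
  have h1 := cos_le_cos_of_nonneg_of_le_pi (arccos_nonneg _)
    (show π - arccos (y / √(1 + P.cot (rot M e) ^ 2 + 1 * y ^ 2)) ≤ π by
      linarith [arccos_nonneg (y / √(1 + P.cot (rot M e) ^ 2 + 1 * y ^ 2))])
    (show arccos (x / √(1 + P.cot (rot M e) ^ 2 + 1 * x ^ 2)) ≤ _ by linarith)
  rw [cos_pi_sub, cos_arccos (abs_le.1 (hb x)).1 (abs_le.1 (hb x)).2,
    cos_arccos (abs_le.1 (hb y)).1 (abs_le.1 (hb y)).2] at h1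
  linarith

end GenPolytope

/-! ### The star of a vertex as a support chain. -/

/-- A sum over a cycle of a permutation. -/
theorem sum_cycle_eq_sum_range {D : Type*} [Fintype D] (f : Equiv.Perm D) (d : D)
    (s : Finset D) (hs : ∀ e, e ∈ s ↔ f.SameCycle d e) (g : D → ℝ) :
    ∑ e ∈ s, g e = ∑ k ∈ Finset.range (Function.minimalPeriod f d), g ((f^[k]) d) := by
  symm
  refine Finset.sum_bij (fun k _ => (f^[k]) d) ?_ ?_ ?_ fun _ _ => rfl
  · intro k _
    rw [hs]
    exact ⟨k, by rw [zpow_natCast, Equiv.Perm.iterate_eq_pow]⟩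
  · intro a ha b hb hab
    exact Function.iterate_injOn_Iio_minimalPeriod (Finset.mem_range.1 ha) (Finset.mem_range.1 hb)
      hab
  · intro e he
    obtain ⟨n, hn⟩ := ((hs e).1 he).exists_nat_pow_eq
    have hper : 0 < Function.minimalPeriod f d :=
      Function.minimalPeriod_pos_of_mem_periodicPts (f.injective.mem_periodicPts d)
    refine ⟨n % Function.minimalPeriod f d, Finset.mem_range.2 (Nat.mod_lt _ hper), ?_⟩
    rw [Function.iterate_mod_minimalPeriod_eq, Equiv.Perm.iterate_eq_pow, hn]

namespace GenPolytope

variable {V D : Type*} [Fintype V] [Fintype D] [DecidableEq V] {M : PolyhedralSphere V D}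
  {P : GenPolytope M}

theorem sum_star_eq (d : D) (g : D → ℝ) : ∑ e with M.org e = M.org d, g e
    = ∑ k ∈ Finset.range (Function.minimalPeriod (rot M) d), g (((rot M)^[k]) d) := by
  refine sum_cycle_eq_sum_range _ _ _ (fun e => ?_) g
  rw [Finset.mem_filter_univ, eq_comm, M.org_eq_iff]
  rfl

/-- The polygon dual to the star of a vertex, starting with the dart `d`. -/
noncomputable def starChain (hP : P.IsConvex) (d : D) (hκ : 0 < P.curvature (M.org d)) :
    SupportChain where
  m := Function.minimalPeriod (rot M) d
  H k := P.cot (((rot M)^[k]) d)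
  ω k := P.radialAngle (((rot M)^[k]) d)
  ω_mem k := P.radialAngle_mem _
  H_add k := by rw [Function.iterate_add_minimalPeriod_eq]
  ω_add k := by rw [Function.iterate_add_minimalPeriod_eq]
  len_nonneg k := by
    have h := hP.edgeLength_nonneg (((rot M)^[k + 1]) d)
    rw [r_mul_hLeft, Function.iterate_succ_apply', r_mul_hRight] at h
    simpa only [Function.iterate_succ_apply'] using h
  total_lt := by
    have := sum_star_eq (M := M) d P.radialAngle
    unfold curvature at hκ
    linarith

theorem excess_starChain (hP : P.IsConvex) (d : D) (hκ : 0 < P.curvature (M.org d)) :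
    (starChain hP d hκ).excess = M.defect (M.org d) - P.curvature (M.org d) := by
  have h := sum_star_eq (M := M) d fun e => P.radialAngle e - M.cornerAngle e
  rw [Finset.sum_sub_distrib] at h
  have h2 : (starChain hP d hκ).excess = ∑ k ∈ Finset.range (Function.minimalPeriod (rot M) d),
      (P.radialAngle (((rot M)^[k]) d) - M.cornerAngle (((rot M)^[k]) d)) := by
    refine Finset.sum_congr rfl fun k _ => ?_
    rw [P.cornerAngle_eq]
    simp only [starChain, Function.iterate_succ_apply']
  rw [h2, ← h, PolyhedralSphere.defect, curvature]
  ring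

/-- Scaling by `r` multiplies the face area by `r²`, and the sum is twice the area. The chain counts
edges from `1` on, so the sum over the cycle is shifted by one step. -/
theorem area_starChain (hP : P.IsConvex) (d : D) (hκ : 0 < P.curvature (M.org d)) :
    ∑ k ∈ Finset.range (starChain hP d hκ).m,
      (starChain hP d hκ).H (k + 1) * (starChain hP d hκ).len k
      = 2 * P.r (M.org d) ^ 2 * P.dual.faceArea (M.org d) := by
  set g : D → ℝ := fun e => P.cot e *
    (P.r (M.org e) * P.dual.hLeft e + P.r (M.org e) * P.dual.hRight e) with hg
  have h1 : 2 * P.r (M.org d) ^ 2 * P.dual.faceArea (M.org d)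
      = ∑ e with M.org e = M.org d, g e := by
    rw [GenPolyhedron.faceArea, ← mul_assoc, Finset.mul_sum]
    refine Finset.sum_congr rfl fun e he => ?_
    rw [Finset.mem_filter_univ] at he
    rw [hg]
    simp only
    rw [cot, he, GenPolyhedron.edgeLength]
    ring
  have h2 : ∀ k, g (((rot M)^[k + 1]) d)
      = (starChain hP d hκ).H (k + 1) * (starChain hP d hκ).len k := by
    intro k
    simp only [hg]
    rw [r_mul_hLeft, Function.iterate_succ_apply', r_mul_hRight]
    simp only [SupportChain.len, SupportChain.fwd, SupportChain.bwd, starChain,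
      Function.iterate_succ_apply']
  have h3 := Finset.sum_range_succ (fun k => g (((rot M)^[k]) d))
    (Function.minimalPeriod (rot M) d)
  rw [Finset.sum_range_succ', Function.iterate_minimalPeriod, Function.iterate_zero, id] at h3
  rw [h1, sum_star_eq, ← add_right_cancel h3]
  exact Finset.sum_congr rfl fun k _ => (h2 k).symm

end GenPolytope

theorem mainTheorem8 {V D : Type*} [Fintype V] [Fintype D] [DecidableEq V]
    (M : PolyhedralSphere V D) (P : GenPolytope M) (hconv : P.IsConvex)
    (hκ : ∀ i : V, 0 < P.curvature i ∧ P.curvature i < M.defect i) :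
    ∀ i : V, 0 < P.dual.faceArea i := by
  intro i
  obtain ⟨d₀, rfl⟩ := M.org_surjective i
  suffices h : ∃ d, M.org d = M.org d₀ ∧ 0 < ∑ k ∈ Finset.range (GenPolytope.starChain hconv d (hκ _).1).m,
      (GenPolytope.starChain hconv d (hκ _).1).H (k + 1) * (GenPolytope.starChain hconv d (hκ _).1).len k by
    obtain ⟨d, hd, h⟩ := h
    rw [GenPolytope.area_starChain, hd] at h
    have := P.r_pos (M.org d₀)
    exact pos_of_mul_pos_right h (by positivity)
  have hex : ∀ d, 0 < (GenPolytope.starChain hconv d (hκ _).1).excess := fun d => by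
    rw [GenPolytope.excess_starChain]
    exact sub_pos.2 (hκ _).2
  -- The star is cut open where the cotangent passes from nonpositive to positive. If there is no
  -- such place, one nonpositive cotangent makes all of them nonpositive around the vertex, against
  -- the positive excess.
  by_cases hsc : ∃ d, M.org d = M.org d₀ ∧ P.cot d ≤ 0 ∧ 0 < P.cot (GenPolytope.rot M d)
  · obtain ⟨d, hd, h0, h1⟩ := hsc
    exact ⟨d, hd, SupportChain.area_pos_of_sign_change _ h0 h1 (hex d)⟩
  push Not at hsc
  by_cases hneg : ∃ d, M.org d = M.org d₀ ∧ P.cot d ≤ 0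
  · obtain ⟨d, hd, h0⟩ := hneg
    have hall : ∀ k, P.cot (((GenPolytope.rot M)^[k]) d) ≤ 0 := by
      intro k
      induction k with
      | zero => exact h0
      | succ k ih =>
        rw [Function.iterate_succ_apply']
        exact hsc _ ((GenPolytope.org_iterate_rot d k).trans hd) ih
    exact absurd ((GenPolytope.starChain hconv d (hκ _).1).excess_nonpos_of_nonpos fun k _ => hall (k + 1))
      (not_le.2 (hex d))
  · push Not at hneg
    exact ⟨d₀, rfl, SupportChain.area_pos_of_nonneg _
      (fun k _ => (hneg _ (GenPolytope.org_iterate_rot d₀ (k + 1))).le) (hex d₀)⟩
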